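/- **Setting.** Let $m\ge 1$, $1>\alpha_1>\dots>\alpha_m>0$, $\mu_1,\dots,\mu_m>0$, $T>0$, $N\in\mathbb N$, $r\ge 1$. On the graded mesh $t_n=T(n/N)^r$ $(0\le n\le N)$ put $\tau_n=t_n-t_{n-1}$ $(1\le n\le N)$. Let $\sigma_n^\star$ be the unique root in $[\min_s(1-\frac{\alpha_s}{2}),\max_s(1-\frac{\alpha_s}{2})]$ of $$\mathcal G_n(\sigma)=\sum_{s=1}^m\frac{\mu_s}{\Gamma(3-\alpha_s)}\,\sigma^{1-\alpha_s}\Big[\sigma-\Big(1-\frac{\alpha_s}{2}\Big)\Big]\tau_n^{2-\alpha_s},$$ and let $\sigma_n=1-\sigma_n^\star$, $t_{n-\sigma_n}=(1-\sigma_n)t_n+\sigma_nt_{n-1}$, $t_{j-\frac12}=\frac12(t_{j-1}+t_j)$. Put $$a^{s}_{n,j}=\frac{1}{\Gamma(1-\alpha_s)}\int_{t_{j-1}}^{t_j}(t_{n-\sigma_n}-\eta)^{-\alpha_s}\,d\eta\quad(1\le j\le n-1),\qquad a^{s}_{n,n}=\frac{1}{\Gamma(1-\alpha_s)}\int_{t_{n-1}}^{t_{n-\sigma_n}}(t_{n-\sigma_n}-\eta)^{-\alpha_s}\,d\eta,$$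 $$b^{s}_{n,j}=\frac{2}{\Gamma(1-\alpha_s)(t_{j+1}-t_{j-1})}\int_{t_{j-1}}^{t_j}(t_{n-\sigma_n}-\eta)^{-\alpha_s}(\eta-t_{j-\frac12})\,d\eta\quad(1\le j\le n-1),$$ $g^s_{1,1}=\tau_1^{-1}a^s_{1,1}$, and for $n\ge2$: $g^s_{n,1}=\tau_1^{-1}(a^s_{n,1}-b^s_{n,1})$, $g^s_{n,j}=\tau_j^{-1}(a^s_{n,j}+b^s_{n,j-1}-b^s_{n,j})$ for $2\le j\le n-1$, $g^s_{n,n}=\tau_n^{-1}(a^s_{n,n}+b^s_{n,n-1})$. The $L2$-$1_\sigma$ operator is $$D_Nv^{n-\sigma_n}=\sum_{j=1}^n g_{n,j}(v^j-v^{j-1}),\qquad g_{n,j}=\sum_{s=1}^m\mu_s\,g^s_{n,j}.$$ Write also $v^{n,\sigma_n}=(1-\sigma_n)v^n+\sigma_nv^{n-1}$ and, for $n\ge2$, $\widehat v^{\,n-\sigma_n}=\frac{\tau_{n-1}+(1-\sigma_n)\tau_n}{\tau_{n-1}}v^{n-1}-\frac{(1-\sigma_n)\tau_n}{\tau_{n-1}}v^{n-2}$.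 Let $\Omega\subset\mathbb R^d$ be a bounded open set, $(\cdot,\cdot)$ and $\|\cdot\|$ the inner product and norm of $L^2(\Omega)$ (and of $L^2(\Omega;\mathbb R^d)$), $l(u)=\int_\Omega u\,dx$, and let $V_h$ be a finite-dimensional subspace of $H^1_0(\Omega)$ (for instance, the continuous piecewise linear finite elements). Let $a:\mathbb R\to\mathbb R$ satisfy $a(x)\ge m_1>0$ for all $x$. Let $f$ be a function of time with values in $L^2(\Omega)$, and $f^{n-\sigma_n}=f(t_{n-\sigma_n})$. Let $U^0,\dots,U^N\in V_h$ solve the fully discrete scheme: for all $v_h\in V_h$, $$(D_NU^{1-\sigma_1},v_h)+a\big(l(U^{1,\sigma_1})\big)(\nabla U^{1,\sigma_1},\nabla v_h)=(f^{1-\sigma_1},v_h),$$ $$(D_NU^{n-\sigma_n},v_h)+a\big(l(\widehat U^{\,n-\sigma_n})\big)(\nabla U^{n,\sigma_n},\nabla v_h)=(f^{n-\sigma_n},v_h)\qquad(2\le n\le N).$$ **Theorem.** For each $n=1,\dots,N$, $$\|U^n\|\le C_n\,(1+\|U^0\|),\qquad \|\nabla U^n\|\le C_n'\,(1+\|\nabla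 U^0\|),$$ where, with the Mittag-Leffler function $E_\alpha(x)=\sum_{k\ge0}\frac{x^k}{\Gamma(1+k\alpha)}$, $$C_n=2E_{\alpha_1}\!\Big(\frac{11}{2\mu_1}t_n^{\alpha_1}\Big)\max\Big\{1,\Big(\frac{11\,T^{\alpha_1}}{4\min_{s}(\mu_s\Gamma(1+\alpha_s))}+1\Big)\max_{1\le j\le n}\|f^{j-\sigma_j}\|\Big\},$$ $$C_n'=2E_{\alpha_1}\!\Big(\frac{11}{2\mu_1}t_n^{\alpha_1}\Big)\max\Big\{1,\frac1{\sqrt{m_1}}\Big(\frac{11\,T^{\alpha_1}}{4\min_{s}(\mu_s\Gamma(1+\alpha_s))}+1\Big)\max_{1\le j\le n}\|f^{j-\sigma_j}\|\Big\}.$$ -/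

import Mathlib

open MeasureTheory
open scoped ContDiff

noncomputable section

namespace FracNonlocal

/-! ## Function spaces -/

/-- `L²(Ω)`. -/
abbrev L2 {d : ℕ} (Ω : Set (EuclideanSpace ℝ (Fin d))) : Type :=
  Lp ℝ 2 (volume.restrict Ω)

/-- `L²(Ω; ℝ^d)`, with norm `(∫_Ω |G|²)^{1/2}`, `|·|` Euclidean. -/
abbrev L2Vec {d : ℕ} (Ω : Set (EuclideanSpace ℝ (Fin d))) : Type :=
  Lp (EuclideanSpace ℝ (Fin d)) 2 (volume.restrict Ω)

/-- The pairs `(φ, ∇φ)` with `φ ∈ C_c^∞(Ω)`, as elements of `L²(Ω) × L²(Ω; ℝ^d)`. -/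
def testPairs {d : ℕ} (Ω : Set (EuclideanSpace ℝ (Fin d))) : Set (L2 Ω × L2Vec Ω) :=
  {p | ∃ φ : EuclideanSpace ℝ (Fin d) → ℝ,
      ContDiff ℝ ∞ φ ∧ HasCompactSupport φ ∧ tsupport φ ⊆ Ω ∧
      p.1 =ᵐ[volume.restrict Ω] φ ∧ p.2 =ᵐ[volume.restrict Ω] gradient φ}

/-- The Sobolev space `H¹₀(Ω)`: the closure of `C_c^∞(Ω)` in the `H¹` norm. A function
`u ∈ H¹₀(Ω)` is recorded together with its weak gradient, as the pair `(u, ∇u)`; the topology of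
`L²(Ω) × L²(Ω; ℝ^d)` on such pairs is that of the `H¹` norm. -/
def H10 {d : ℕ} (Ω : Set (EuclideanSpace ℝ (Fin d))) : Submodule ℝ (L2 Ω × L2Vec Ω) :=
  (Submodule.span ℝ (testPairs Ω)).topologicalClosure

/-- The nonlocal quantity `l(u) = ∫_Ω u dx`. -/
def nonlocalInt {d : ℕ} {Ω : Set (EuclideanSpace ℝ (Fin d))} (u : L2 Ω) : ℝ :=
  ∫ x in Ω, u x

/-! ## The Mittag-Leffler function -/

/-- `E_α(x) = ∑_{k ≥ 0} x^k / Γ(1 + k α)`. -/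
def mittagLeffler (α x : ℝ) : ℝ :=
  ∑' k : ℕ, x ^ k / Real.Gamma (1 + k * α)

/-! ## Time discretization: the `L2-1_σ` scheme on the graded mesh -/

/-- The parameters of the multi-term fractional derivative and of the graded mesh. The orders
`α_1 > ⋯ > α_m` are indexed by `0, …, m - 1`, so that `α_1`, `μ_1` are `α 0`, `μ 0`. -/
structure TimeParams (m : ℕ) where
  /-- final time -/
  T : ℝ
  T_pos : 0 < T
  /-- number of time steps -/
  N : ℕ
  /-- mesh grading parameter -/
  r : ℝ
  one_le_r : 1 ≤ r
  /-- fractional orders -/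
  α : Fin m → ℝ
  α_pos : ∀ s, 0 < α s
  α_lt_one : ∀ s, α s < 1
  α_anti : StrictAnti α
  /-- weights of the fractional derivatives -/
  μ : Fin m → ℝ
  μ_pos : ∀ s, 0 < μ s

namespace TimeParams

variable {m : ℕ} (P : TimeParams m)

/-- Grid points `t_n = T (n / N)^r`. -/
def t (n : ℕ) : ℝ := P.T * ((n : ℝ) / (P.N : ℝ)) ^ P.r

/-- Step sizes `τ_n = t_n - t_{n-1}` (used for `n ≥ 1`). -/
def τ (n : ℕ) : ℝ := P.t n - P.t (n - 1)

/-- `𝒢_n(σ) = ∑_s μ_s / Γ(3 - α_s) σ^{1 - α_s} [σ - (1 - α_s / 2)] τ_n^{2 - α_s}`. -/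
def G (n : ℕ) (x : ℝ) : ℝ :=
  ∑ s, P.μ s / Real.Gamma (3 - P.α s) * x ^ (1 - P.α s) * (x - (1 - P.α s / 2))
    * P.τ n ^ (2 - P.α s)

/-- `σ*_n`, the root of `𝒢_n` in `[b₁, b₂] = [min_s (1 - α_s / 2), max_s (1 - α_s / 2)]`. There is
exactly one for `1 ≤ n ≤ N` and `m ≥ 1`, and `sInf` picks it out of the one-point set of roots. -/
def σStar (n : ℕ) : ℝ :=
  sInf {x | x ∈ Set.Icc (⨅ s, (1 - P.α s / 2)) (⨆ s, (1 - P.α s / 2)) ∧ P.G n x = 0}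

/-- `σ_n = 1 - σ*_n`. -/
def σ (n : ℕ) : ℝ := 1 - P.σStar n

/-- `t_{n-σ_n} = (1 - σ_n) t_n + σ_n t_{n-1}`. -/
def tσ (n : ℕ) : ℝ := (1 - P.σ n) * P.t n + P.σ n * P.t (n - 1)

/-- `a_{n,j}^{(α_s, σ_n)}`, for `1 ≤ j ≤ n`. -/
def aCoef (s : Fin m) (n j : ℕ) : ℝ :=
  1 / Real.Gamma (1 - P.α s) *
    ∫ η in P.t (j - 1)..(if j = n then P.tσ n else P.t j), (P.tσ n - η) ^ (-P.α s)

/-- `b_{n,j}^{(α_s, σ_n)}`, for `1 ≤ j ≤ n - 1`; here `t_{j-1/2} = (t_{j-1} + t_j) / 2`. -/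
def bCoef (s : Fin m) (n j : ℕ) : ℝ :=
  2 / (Real.Gamma (1 - P.α s) * (P.t (j + 1) - P.t (j - 1))) *
    ∫ η in P.t (j - 1)..P.t j,
      (P.tσ n - η) ^ (-P.α s) * (η - (P.t (j - 1) + P.t j) / 2)

/-- The single-term coefficients `g_{n,j}^{(α_s, σ_n)}`, for `1 ≤ j ≤ n`. -/
def gSingle (s : Fin m) (n j : ℕ) : ℝ :=
  (P.τ j)⁻¹ *
    (if n = 1 then P.aCoef s n j
     else if j = 1 then P.aCoef s n j - P.bCoef s n j
     else if j = n then P.aCoef s n j + P.bCoef s n (j - 1)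
     else P.aCoef s n j + P.bCoef s n (j - 1) - P.bCoef s n j)

/-- The multi-term coefficients `g_{n,j} = ∑_s μ_s g_{n,j}^{(α_s, σ_n)}`. -/
def g (n j : ℕ) : ℝ := ∑ s, P.μ s * P.gSingle s n j

variable {V : Type*} [AddCommGroup V] [Module ℝ V]

/-- `D_N v^{n-σ_n} = ∑_{j=1}^n g_{n,j} (v^j - v^{j-1})`. -/
def DN (v : ℕ → V) (n : ℕ) : V :=
  ∑ j ∈ Finset.Icc 1 n, P.g n j • (v j - v (j - 1))

/-- `v^{n,σ_n} = (1 - σ_n) v^n + σ_n v^{n-1}`, for `n ≥ 1`. -/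
def wavg (v : ℕ → V) (n : ℕ) : V := (1 - P.σ n) • v n + P.σ n • v (n - 1)

/-- The extrapolation `v̂^{n-σ_n}`, for `n ≥ 2`. -/
def extrap (v : ℕ → V) (n : ℕ) : V :=
  ((P.τ (n - 1) + (1 - P.σ n) * P.τ n) / P.τ (n - 1)) • v (n - 1)
    - ((1 - P.σ n) * P.τ n / P.τ (n - 1)) • v (n - 2)

end TimeParams

/-! ## The fully discrete scheme -/

/-- `U^0, …, U^N ∈ V_h` solve the fully discrete scheme with diffusion coefficient `a`, right-hand
side `f` (a function of time with values in `L²(Ω)`) and initial value `U^0`. The components of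
`U n` are `U^n` and `∇U^n`. -/
structure IsFullyDiscreteSolution {m d : ℕ} (P : TimeParams m)
    {Ω : Set (EuclideanSpace ℝ (Fin d))} (Vh : Submodule ℝ (L2 Ω × L2Vec Ω))
    (a : ℝ → ℝ) (f : ℝ → L2 Ω) (U : ℕ → L2 Ω × L2Vec Ω) : Prop where
  mem : ∀ n ≤ P.N, U n ∈ Vh
  first_step : 1 ≤ P.N → ∀ v ∈ Vh,
    inner ℝ (P.DN U 1).1 v.1
      + a (nonlocalInt (P.wavg U 1).1) * inner ℝ (P.wavg U 1).2 v.2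
      = inner ℝ (f (P.tσ 1)) v.1
  step : ∀ n, 2 ≤ n → n ≤ P.N → ∀ v ∈ Vh,
    inner ℝ (P.DN U n).1 v.1
      + a (nonlocalInt (P.extrap U n).1) * inner ℝ (P.wavg U n).2 v.2
      = inner ℝ (f (P.tσ n)) v.1

/-- `max_{1 ≤ j ≤ n} ‖f^{j-σ_j}‖`. -/
def maxSource {m d : ℕ} (P : TimeParams m) {Ω : Set (EuclideanSpace ℝ (Fin d))}
    (f : ℝ → L2 Ω) (n : ℕ) : ℝ :=
  ⨆ j : Set.Icc 1 n, ‖f (P.tσ (j : ℕ))‖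

end FracNonlocal

end

namespace FracNonlocal

/-! ## Discrete convolution sums with monotone kernels -/

/-! The diffusion coefficient enters only through its lower bound, so the estimates are linear
energy estimates and need no Gronwall argument; of the Mittag-Leffler factor only
`one_le_mittagLeffler` is used.

Everything rests on the weights `g n j` being positive and nondecreasing in `j`, and on
`σStar_sq_mul_g_le`, which controls the last two weights. Abel summation
(`sum_mul_sub_le_of_monotone`) then gives a discrete maximum principle, and coercivity of `DN`
against `wavg` (`half_sum_norm_sq_le_inner_wavg`). Monotonicity comes from squeezing the `j`-th
weight between kernel values at `t_{j-1}` and `t_j` (`kernel_le_gSingle`, `gSingle_le_kernel`),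
using convexity of the kernel and nondecreasing steps.

The multiple `t^{α_1}/(μ_1 Γ(1+α_1))` of a power has discrete derivative at least `1/2`
(`half_le_sum_barrier`). By the maximum principle, a sequence whose discrete derivative is at most
`C` therefore grows by at most `2C` times the barrier at `T`. Testing with `wavg U` yields the `L²`
bound; testing with `DN U` and completing a square yields the gradient bound. -/

lemma sum_mul_sub_le_of_monotone {g q : ℕ → ℝ} {n : ℕ} (hn : 1 ≤ n)
    (hg : ∀ j, 1 ≤ j → j ≤ n → 0 ≤ g j)
    (hmono : ∀ j, 1 ≤ j → j < n → g j ≤ g (j + 1)) (hq : ∀ j < n, 0 ≤ q j) :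
    ∑ j ∈ Finset.Icc 1 n, g j * (q j - q (j - 1)) ≤ g n * q n := by
  induction n, hn using Nat.le_induction with
  | base =>
    have := mul_nonneg (hg 1 le_rfl le_rfl) (hq 0 one_pos)
    simp; linarith
  | succ k hk ih =>
    rw [Finset.sum_Icc_succ_top (by omega)]
    have h1 := ih (fun j h h' => hg j h (by omega)) (fun j h h' => hmono j h (by omega))
      (fun j h => hq j (by omega))
    have h2 := mul_le_mul_of_nonneg_right (hmono k hk (by omega)) (hq k (by omega))
    simp only [Nat.add_sub_cancel]
    linarith

/-- Discrete maximum principle. -/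
lemma le_initial_of_sum_nonpos {g : ℕ → ℕ → ℝ} {z : ℕ → ℝ} {N : ℕ}
    (hg : ∀ n, 1 ≤ n → n ≤ N → ∀ j, 1 ≤ j → j ≤ n → 0 < g n j)
    (hmono : ∀ n, 1 ≤ n → n ≤ N → ∀ j, 1 ≤ j → j < n → g n j ≤ g n (j + 1))
    (hz : ∀ n, 1 ≤ n → n ≤ N → ∑ j ∈ Finset.Icc 1 n, g n j * (z j - z (j - 1)) ≤ 0) :
    ∀ n ≤ N, z n ≤ z 0 := by
  intro n
  induction n using Nat.strong_induction_on with
  | _ n ih =>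
    intro hnN
    rcases Nat.eq_zero_or_pos n with rfl | hn
    · exact le_rfl
    -- By induction `z 0 - z j` is nonnegative for `j < n`; its sign at `j = n` is not needed, and
    -- is the conclusion.
    have h1 := sum_mul_sub_le_of_monotone (q := fun j => z 0 - z j) hn
      (fun j h h' => (hg n hn hnN j h h').le) (hmono n hn hnN)
      (fun j h => sub_nonneg.2 (ih j h (by omega)))
    have h2 : ∑ j ∈ Finset.Icc 1 n, g n j * ((z 0 - z j) - (z 0 - z (j - 1)))
        = -∑ j ∈ Finset.Icc 1 n, g n j * (z j - z (j - 1)) := by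
      rw [← Finset.sum_neg_distrib]
      exact Finset.sum_congr rfl fun j _ => by ring
    have h3 : 0 ≤ g n n * (z 0 - z n) := by
      have := hz n hn hnN
      linarith
    exact sub_nonneg.1 (nonneg_of_mul_nonneg_right h3 (hg n hn hnN n hn le_rfl))

/-- Coercivity of a discrete convolution derivative, tested with the weighted average
`θ v^n + (1 - θ) v^{n-1}`. -/
lemma half_sum_norm_sq_le_inner {H : Type*} [NormedAddCommGroup H] [InnerProductSpace ℝ H]
    {g : ℕ → ℝ} {v : ℕ → H} {n : ℕ} {θ : ℝ} (hn : 1 ≤ n)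
    (hg : ∀ j, 1 ≤ j → j ≤ n → 0 ≤ g j)
    (hmono : ∀ j, 1 ≤ j → j < n → g j ≤ g (j + 1)) (hθ : 1 / 2 ≤ θ)
    (hlast : 2 ≤ n → θ ^ 2 * g (n - 1) ≤ (2 * θ - 1) * g n) :
    (∑ j ∈ Finset.Icc 1 n, g j * (‖v j‖ ^ 2 - ‖v (j - 1)‖ ^ 2)) / 2 ≤
      inner ℝ (θ • v n + (1 - θ) • v (n - 1)) (∑ j ∈ Finset.Icc 1 n, g j • (v j - v (j - 1))) := by
  set c := θ • v n + (1 - θ) • v (n - 1) with hc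
  -- Completing squares around the test vector `c` turns the claim into `∑ g j (q j - q (j-1)) ≤ 0`.
  -- The last term is `-(2θ-1) g n ‖v n - v (n-1)‖²`, the others sum to at most `g (n-1) θ² ‖v n - v
  -- (n-1)‖²`, and `hlast` balances the two.
  set q : ℕ → ℝ := fun j => ‖v j - c‖ ^ 2 with hq
  have hqe : ∀ j, q j = ‖v j‖ ^ 2 - 2 * inner ℝ c (v j) + ‖c‖ ^ 2 := fun j => by
    rw [hq]; simp only; rw [norm_sub_sq_real, real_inner_comm]
  have key : ∑ j ∈ Finset.Icc 1 n, g j * (q j - q (j - 1)) ≤ 0 := by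
    have hqn : q n = (1 - θ) ^ 2 * ‖v n - v (n - 1)‖ ^ 2 := by
      have : v n - c = (1 - θ) • (v n - v (n - 1)) := by rw [hc]; module
      rw [hq]; simp only [this, norm_smul, mul_pow, Real.norm_eq_abs, sq_abs]
    have hqn' : q (n - 1) = θ ^ 2 * ‖v n - v (n - 1)‖ ^ 2 := by
      have : v (n - 1) - c = (-θ) • (v n - v (n - 1)) := by rw [hc]; module
      rw [hq]; simp only [this, norm_smul, mul_pow, Real.norm_eq_abs, sq_abs, neg_sq]
    have hD := sq_nonneg ‖v n - v (n - 1)‖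
    obtain ⟨k, rfl⟩ : ∃ k, n = k + 1 := ⟨n - 1, by omega⟩
    simp only [Nat.add_sub_cancel] at *
    rw [Finset.sum_Icc_succ_top (by omega)]
    simp only [Nat.add_sub_cancel]
    rw [hqn, hqn']
    rcases Nat.eq_zero_or_pos k with rfl | hk
    · have := mul_nonneg (mul_nonneg (hg 1 le_rfl le_rfl) (by linarith : 0 ≤ 2 * θ - 1)) hD
      simp at this ⊢
      linarith
    · have h1 := sum_mul_sub_le_of_monotone (g := g) (q := q) hk
        (fun j h h' => hg j h (by omega)) (fun j h h' => hmono j h (by omega))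
        (fun j _ => sq_nonneg _)
      rw [hqn'] at h1
      have h2 := mul_le_mul_of_nonneg_right (hlast (by omega)) hD
      linarith
  have hsum : ∑ j ∈ Finset.Icc 1 n, g j * (q j - q (j - 1))
      = ∑ j ∈ Finset.Icc 1 n, g j * (‖v j‖ ^ 2 - ‖v (j - 1)‖ ^ 2)
        - 2 * inner ℝ c (∑ j ∈ Finset.Icc 1 n, g j • (v j - v (j - 1))) := by
    rw [inner_sum, Finset.mul_sum, ← Finset.sum_sub_distrib]
    refine Finset.sum_congr rfl fun j _ => ?_
    rw [hqe, hqe, real_inner_smul_right, inner_sub_right]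
    ring
  linarith

/-! ## The Mittag-Leffler function -/

/-- Truncate Euler's integral to `t > A`, where `t^(x-1) ≥ A^(x-1)`. Since `A` is free, `Γ` outgrows
every geometric sequence. -/
lemma rpow_mul_exp_neg_le_Gamma {A x : ℝ} (hA : 0 < A) (hx : 1 ≤ x) :
    A ^ (x - 1) * Real.exp (-A) ≤ Real.Gamma x := by
  have hint := Real.GammaIntegral_convergent (zero_lt_one.trans_le hx)
  have hsub : Set.Ioi A ⊆ Set.Ioi 0 := Set.Ioi_subset_Ioi hA.le
  rw [Real.Gamma_eq_integral (zero_lt_one.trans_le hx)]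
  calc A ^ (x - 1) * Real.exp (-A) = ∫ t in Set.Ioi A, Real.exp (-t) * A ^ (x - 1) := by
        rw [integral_mul_const, integral_exp_neg_Ioi, mul_comm]
    _ ≤ ∫ t in Set.Ioi A, Real.exp (-t) * t ^ (x - 1) := by
        refine setIntegral_mono_on ((integrableOn_exp_neg_Ioi A).mul_const _)
          (hint.mono_set hsub) measurableSet_Ioi fun t ht => ?_
        exact mul_le_mul_of_nonneg_left
          (Real.rpow_le_rpow hA.le (le_of_lt ht) (by linarith)) (Real.exp_pos _).le
    _ ≤ ∫ t in Set.Ioi 0, Real.exp (-t) * t ^ (x - 1) := by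
        refine setIntegral_mono_set hint ?_ hsub.eventuallyLE
        filter_upwards [ae_restrict_mem measurableSet_Ioi] with t ht
        exact mul_nonneg (Real.exp_pos _).le (Real.rpow_nonneg (le_of_lt ht) _)

lemma summable_mittagLeffler {α x : ℝ} (hα : 0 < α) (hx : 0 ≤ x) :
    Summable fun k : ℕ => x ^ k / Real.Gamma (1 + k * α) := by
  -- Chosen so that `A^(kα) = (x+1)^k`, which dominates the series by a geometric one of ratio
  -- `x/(x+1)`.
  set A : ℝ := (x + 1) ^ α⁻¹ with hA
  have hA0 : 0 < A := by positivity
  have hAα : A ^ α = x + 1 := by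
    rw [hA, ← Real.rpow_mul (by positivity), inv_mul_cancel₀ hα.ne', Real.rpow_one]
  have hr : x / (x + 1) < 1 := by rw [div_lt_one (by positivity)]; linarith
  refine Summable.of_nonneg_of_le (fun k => ?_) (fun k => ?_)
    ((summable_geometric_of_lt_one (by positivity) hr).mul_left (Real.exp A))
  · have : 0 < Real.Gamma (1 + k * α) := Real.Gamma_pos_of_pos (by positivity)
    positivity
  · have h := rpow_mul_exp_neg_le_Gamma (x := 1 + k * α) hA0 (by
      have : 0 ≤ (k : ℝ) * α := by positivity
      linarith)
    have h2 : A ^ (1 + k * α - 1) = (x + 1) ^ k := by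
      rw [show 1 + k * α - 1 = α * k by ring, Real.rpow_mul hA0.le, hAα, Real.rpow_natCast]
    rw [h2] at h
    calc x ^ k / Real.Gamma (1 + k * α) ≤ x ^ k / ((x + 1) ^ k * Real.exp (-A)) :=
          div_le_div_of_nonneg_left (by positivity) (by positivity) h
      _ = Real.exp A * (x / (x + 1)) ^ k := by
          rw [Real.exp_neg, div_pow]; field_simp

/-- The term `k = 0` equals `1` and the rest are nonnegative. Summability matters because a
divergent `tsum` is `0` by convention. -/
lemma one_le_mittagLeffler {α x : ℝ} (hα : 0 < α) (hx : 0 ≤ x) : 1 ≤ mittagLeffler α x := by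
  have h := (summable_mittagLeffler hα hx).le_tsum 0 fun k _ => by
    have : 0 < Real.Gamma (1 + k * α) := Real.Gamma_pos_of_pos (by positivity)
    positivity
  simpa [mittagLeffler] using h

/-! ## Integral inequalities for monotone and convex weights -/

lemma integral_sub_midpoint (a b : ℝ) : ∫ η in a..b, (η - (a + b) / 2) = 0 := by
  rw [intervalIntegral.integral_comp_sub_right (fun y => y)]
  simp; ring

lemma integral_sub_midpoint_sq (a b : ℝ) :
    ∫ η in a..b, (η - (a + b) / 2) ^ 2 = (b - a) ^ 3 / 12 := by
  rw [intervalIntegral.integral_comp_sub_right (fun y => y ^ 2)]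
  simp; ring

/-- Replacing `k` by its midpoint value gives integral zero and, by monotonicity, decreases the
integrand pointwise. -/
lemma integral_mul_sub_midpoint_nonneg {k : ℝ → ℝ} {a b : ℝ} (hab : a ≤ b)
    (hc : ContinuousOn k (Set.Icc a b)) (hk : MonotoneOn k (Set.Icc a b)) :
    0 ≤ ∫ η in a..b, k η * (η - (a + b) / 2) := by
  have h := intervalIntegral.integral_mono_on hab
    (f := fun η => k ((a + b) / 2) * (η - (a + b) / 2))
    (g := fun η => k η * (η - (a + b) / 2))
    (Continuous.intervalIntegrable (μ := volume) (by fun_prop) _ _)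
    (ContinuousOn.intervalIntegrable_of_Icc hab (hc.mul (by fun_prop))) (fun η hη => by
      have hm : (a + b) / 2 ∈ Set.Icc a b := ⟨by linarith, by linarith⟩
      rcases le_total η ((a + b) / 2) with h | h
      · exact mul_le_mul_of_nonpos_right (hk hη hm h) (by linarith)
      · exact mul_le_mul_of_nonneg_right (hk hm hη h) (by linarith))
  rwa [intervalIntegral.integral_const_mul, integral_sub_midpoint, mul_zero] at h

/-- Weighted averages against `1 - β (η - midpoint)`. -/
lemma le_integral_sub_integral_mul_sub_midpoint {k : ℝ → ℝ} {a b β c : ℝ} (hab : a ≤ b)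
    (hc : ContinuousOn k (Set.Icc a b)) (hβ : β * (b - a) ≤ 2) (hβ0 : 0 ≤ β)
    (hk : ∀ η ∈ Set.Icc a b, c ≤ k η) :
    (b - a) * c ≤ (∫ η in a..b, k η) - β * ∫ η in a..b, k η * (η - (a + b) / 2) := by
  have hi1 : IntervalIntegrable k volume a b := hc.intervalIntegrable_of_Icc hab
  have hi2 : IntervalIntegrable (fun η => k η * (η - (a + b) / 2)) volume a b :=
    ContinuousOn.intervalIntegrable_of_Icc hab (hc.mul (by fun_prop))
  rw [← intervalIntegral.integral_const_mul, ← intervalIntegral.integral_sub hi1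
    (hi2.const_mul _)]
  have h := intervalIntegral.integral_mono_on hab
    (f := fun η => c - c * β * (η - (a + b) / 2))
    (g := fun η => k η - β * (k η * (η - (a + b) / 2)))
    (Continuous.intervalIntegrable (μ := volume) (by fun_prop) _ _) (hi1.sub (hi2.const_mul _)) (fun η hη => by
      have h1 : β * (η - (a + b) / 2) ≤ β * ((b - a) / 2) :=
        mul_le_mul_of_nonneg_left (by linarith [hη.2]) hβ0
      nlinarith [hk η hη, mul_nonneg (sub_nonneg.2 (hk η hη))
        (by linarith : 0 ≤ 1 - β * (η - (a + b) / 2))])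
  refine le_trans (le_of_eq ?_) h
  rw [intervalIntegral.integral_sub (by simp) (Continuous.intervalIntegrable (μ := volume) (by fun_prop) _ _),
    intervalIntegral.integral_const_mul, integral_sub_midpoint]
  simp

/-- The weight `1 - β (η - midpoint)` is at least `1/2` on the whole interval. -/
lemma half_integral_le_integral_sub_integral_mul_sub_midpoint {k : ℝ → ℝ} {a b β : ℝ}
    (hab : a ≤ b) (hc : ContinuousOn k (Set.Icc a b)) (hβ : β * (b - a) ≤ 1) (hβ0 : 0 ≤ β)
    (hk : ∀ η ∈ Set.Icc a b, 0 ≤ k η) :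
    (∫ η in a..b, k η) / 2 ≤
      (∫ η in a..b, k η) - β * ∫ η in a..b, k η * (η - (a + b) / 2) := by
  have hi1 : IntervalIntegrable k volume a b := hc.intervalIntegrable_of_Icc hab
  have hi2 : IntervalIntegrable (fun η => k η * (η - (a + b) / 2)) volume a b :=
    ContinuousOn.intervalIntegrable_of_Icc hab (hc.mul (by fun_prop))
  have h := intervalIntegral.integral_mono_on hab
    (f := fun η => β * (k η * (η - (a + b) / 2)))
    (g := fun η => (1 / 2) * k η) (hi2.const_mul _) (hi1.const_mul _) (fun η hη => by
      have h1 : β * (η - (a + b) / 2) ≤ β * ((b - a) / 2) :=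
        mul_le_mul_of_nonneg_left (by linarith [hη.2]) hβ0
      nlinarith [mul_nonneg (hk η hη) (by linarith : 0 ≤ 1 / 2 - β * (η - (a + b) / 2))])
  rw [intervalIntegral.integral_const_mul, intervalIntegral.integral_const_mul] at h
  linarith

lemma slope_le_slope_of_convexOn {k : ℝ → ℝ} {s : Set ℝ} (hk : ConvexOn ℝ s k) {x y b c : ℝ}
    (hx : x ∈ s) (hb : b ∈ s) (hc : c ∈ s) (hxy : x < y) (hyb : y ≤ b) (hbc : b < c) :
    k y - k x ≤ (k c - k b) / (c - b) * (y - x) := by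
  rw [← div_le_iff₀ (by linarith)]
  rcases hyb.eq_or_lt with rfl | hyb
  · exact hk.slope_mono_adjacent hx hc hxy hbc
  · have hy : y ∈ s := hk.1.ordConnected.out hx hb ⟨hxy.le, hyb.le⟩
    exact (hk.slope_mono_adjacent hx hb hxy hyb).trans (hk.slope_mono_adjacent hy hc hyb hbc)

/-- By convexity every slope inside `[a, b]` is at most the chord slope over `[b, c]`, so `k η` may
be compared with a line through the midpoint value; its quadratic part integrates to `(b-a)³/12`. -/
lemma integral_mul_sub_midpoint_le {k : ℝ → ℝ} {a b c : ℝ} (hab : a ≤ b) (hbc : b < c)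
    (hcont : ContinuousOn k (Set.Icc a c)) (hk : ConvexOn ℝ (Set.Icc a c) k) :
    ∫ η in a..b, k η * (η - (a + b) / 2) ≤ (k c - k b) / (c - b) * ((b - a) ^ 3 / 12) := by
  set S := (k c - k b) / (c - b)
  have h := intervalIntegral.integral_mono_on hab
    (f := fun η => k η * (η - (a + b) / 2))
    (g := fun η => k ((a + b) / 2) * (η - (a + b) / 2) + S * (η - (a + b) / 2) ^ 2)
    (ContinuousOn.intervalIntegrable_of_Icc hab
      ((hcont.mono (Set.Icc_subset_Icc_right hbc.le)).mul (by fun_prop)))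
    (Continuous.intervalIntegrable (μ := volume) (by fun_prop) _ _) (fun η hη => by
      have hm : (a + b) / 2 ∈ Set.Icc a c := ⟨by linarith, by linarith⟩
      have hη' : η ∈ Set.Icc a c := ⟨hη.1, by linarith [hη.2]⟩
      have hb : b ∈ Set.Icc a c := ⟨hab, hbc.le⟩
      have hc : c ∈ Set.Icc a c := ⟨by linarith, le_rfl⟩
      rcases lt_trichotomy η ((a + b) / 2) with h | h | h
      · have := slope_le_slope_of_convexOn hk hη' hb hc h (by linarith) hbc
        nlinarith
      · simp [h]
      · have := slope_le_slope_of_convexOn hk hm hb hc h hη.2 hbc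
        nlinarith)
  rwa [intervalIntegral.integral_add (Continuous.intervalIntegrable (μ := volume) (by fun_prop) _ _)
    (Continuous.intervalIntegrable (μ := volume) (by fun_prop) _ _), intervalIntegral.integral_const_mul,
    intervalIntegral.integral_const_mul, integral_sub_midpoint, integral_sub_midpoint_sq,
    mul_zero, zero_add] at h

lemma integral_le_trapezoid {k : ℝ → ℝ} {a b : ℝ} (hab : a < b)
    (hcont : ContinuousOn k (Set.Icc a b)) (hk : ConvexOn ℝ (Set.Icc a b) k) :
    ∫ η in a..b, k η ≤ (b - a) * (k a + k b) / 2 := by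
  have h := intervalIntegral.integral_mono_on hab.le (f := k)
    (g := fun η => (k b - k a) / (b - a) * (η - (a + b) / 2) + (k a + k b) / 2)
    (hcont.intervalIntegrable_of_Icc hab.le)
    (Continuous.intervalIntegrable (μ := volume) (by fun_prop) _ _) (fun η hη => by
      have hba : 0 < b - a := sub_pos.2 hab
      have := hk.2 (Set.left_mem_Icc.2 hab.le) (Set.right_mem_Icc.2 hab.le)
        (div_nonneg (sub_nonneg.2 hη.2) hba.le) (div_nonneg (sub_nonneg.2 hη.1) hba.le)
        (by field_simp; ring)
      simp only [smul_eq_mul] at this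
      have e1 : (b - η) / (b - a) * a + (η - a) / (b - a) * b = η := by field_simp; ring
      rw [e1] at this
      refine this.trans (le_of_eq ?_)
      field_simp; ring)
  rw [intervalIntegral.integral_add (Continuous.intervalIntegrable (μ := volume) (by fun_prop) _ _) (by simp),
    intervalIntegral.integral_const_mul, integral_sub_midpoint] at h
  simp only [mul_zero, intervalIntegral.integral_const, smul_eq_mul, zero_add] at h
  linarith

/-- The trapezoid bound on `[b, c]` leaves a slack of `(c-b)(k c - k b)/2`, and `b - a ≤ c - b`
makes the first-moment term from the previous interval fit into it. -/
lemma integral_add_integral_mul_sub_midpoint_le {k : ℝ → ℝ} {a b c : ℝ} (hab : a < b)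
    (hbc : b < c) (hstep : b - a ≤ c - b) (hcont : ContinuousOn k (Set.Icc a c))
    (hk : ConvexOn ℝ (Set.Icc a c) k) (hmono : k b ≤ k c) :
    (∫ η in b..c, k η) + 2 / (c - a) * ∫ η in a..b, k η * (η - (a + b) / 2) ≤ (c - b) * k c := by
  have h1 := integral_mul_sub_midpoint_le hab.le hbc hcont hk
  have h2 := integral_le_trapezoid hbc (hcont.mono (Set.Icc_subset_Icc_left hab.le))
    (hk.subset (Set.Icc_subset_Icc_left hab.le) (convex_Icc _ _))
  have hca : 0 < c - a := by linarith
  have hcb : 0 < c - b := by linarith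
  have hba : 0 < b - a := by linarith
  have h3 : 2 / (c - a) * ∫ η in a..b, k η * (η - (a + b) / 2) ≤ (k c - k b) * (c - b) / 2 := by
    calc _ ≤ 2 / (c - a) * ((k c - k b) / (c - b) * ((b - a) ^ 3 / 12)) :=
          mul_le_mul_of_nonneg_left h1 (by positivity)
      _ ≤ 2 / (c - a) * ((k c - k b) / (c - b) * ((c - a) * (c - b) ^ 2 / 4)) := by
          have hS : 0 ≤ (k c - k b) / (c - b) := div_nonneg (by linarith) hcb.le
          have hp : (b - a) ^ 3 / 12 ≤ (c - a) * (c - b) ^ 2 / 4 := by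
            have h4 : (b - a) ^ 2 ≤ (c - b) ^ 2 := by gcongr
            have h5 : (b - a) * (b - a) ^ 2 ≤ (c - a) * (c - b) ^ 2 := by gcongr
            have h6 : 0 ≤ (c - a) * (c - b) ^ 2 := by positivity
            nlinarith
          gcongr
      _ = _ := by field_simp; ring
  linarith

/-- Chebyshev's integral inequality for oppositely ordered functions. -/
lemma integral_mul_le_of_monotoneOn_antitoneOn {k h : ℝ → ℝ} {a b : ℝ} (hab : a ≤ b)
    (hk : MonotoneOn k (Set.Ioo a b)) (hh : AntitoneOn h (Set.Ioo a b))
    (ik : IntervalIntegrable k volume a b) (ih : IntervalIntegrable h volume a b)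
    (ikh : IntervalIntegrable (fun x => k x * h x) volume a b) :
    (b - a) * ∫ x in a..b, k x * h x ≤ (∫ x in a..b, k x) * ∫ x in a..b, h x := by
  set K := ∫ x in a..b, k x
  set H := ∫ x in a..b, h x
  set M := ∫ x in a..b, k x * h x
  -- Integrate `(k x - k y)(h x - h y) ≤ 0` in `y`; integrating again in `x` gives twice the claim.
  have inner_le : ∀ x ∈ Set.Ioo a b,
      (b - a) * (k x * h x) - k x * H - h x * K + M ≤ 0 := by
    intro x hx
    have h1 := intervalIntegral.integral_mono_on_of_le_Ioo hab
      (f := fun y => k x * h x - k x * h y - h x * k y + k y * h y) (g := fun _ => (0 : ℝ))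
      (((((intervalIntegrable_const).sub (ih.const_mul _)).sub (ik.const_mul _))).add ikh)
      intervalIntegrable_const (fun y hy => by
        rcases le_total x y with hxy | hxy
        · nlinarith [mul_nonneg (sub_nonneg.2 (hk hx hy hxy)) (sub_nonneg.2 (hh hx hy hxy))]
        · nlinarith [mul_nonneg (sub_nonneg.2 (hk hy hx hxy)) (sub_nonneg.2 (hh hy hx hxy))])
    rw [intervalIntegral.integral_add ((((intervalIntegrable_const).sub (ih.const_mul _)).sub
      (ik.const_mul _))) ikh, intervalIntegral.integral_sub
      ((intervalIntegrable_const).sub (ih.const_mul _)) (ik.const_mul _),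
      intervalIntegral.integral_sub intervalIntegrable_const (ih.const_mul _),
      intervalIntegral.integral_const_mul, intervalIntegral.integral_const_mul] at h1
    simp only [intervalIntegral.integral_const, intervalIntegral.integral_const_mul, smul_eq_mul,
      mul_zero] at h1
    refine le_trans (le_of_eq ?_) h1
    simp only [K, H, M]
    ring
  have h2 := intervalIntegral.integral_mono_on_of_le_Ioo hab
    (f := fun x => (b - a) * (k x * h x) - k x * H - h x * K + M) (g := fun _ => (0 : ℝ))
    ((((ikh.const_mul _).sub (ik.mul_const _)).sub (ih.mul_const _)).add intervalIntegrable_const)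
    intervalIntegrable_const inner_le
  rw [intervalIntegral.integral_add (((ikh.const_mul _).sub (ik.mul_const _)).sub
    (ih.mul_const _)) intervalIntegrable_const, intervalIntegral.integral_sub
    ((ikh.const_mul _).sub (ik.mul_const _)) (ih.mul_const _),
    intervalIntegral.integral_sub (ikh.const_mul _) (ik.mul_const _),
    intervalIntegral.integral_const_mul, intervalIntegral.integral_mul_const,
    intervalIntegral.integral_mul_const] at h2
  simp only [intervalIntegral.integral_const, smul_eq_mul, mul_zero] at h2
  change (b - a) * M - K * H - H * K + (b - a) * M ≤ 0 at h2
  linarith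

/-! ## Real powers -/

lemma convexOn_rpow_neg {α : ℝ} (hα : 0 ≤ α) :
    ConvexOn ℝ (Set.Ioi 0) fun x : ℝ => x ^ (-α) := by
  have h1 : ConvexOn ℝ (Set.Ioi 0) fun x : ℝ => -α * Real.log x := by
    have := (strictConcaveOn_log_Ioi.concaveOn.smul hα).neg
    refine this.congr fun x _ => ?_
    simp
  have h2 : ConvexOn ℝ (Set.Ioi 0) (Real.exp ∘ fun x : ℝ => -α * Real.log x) :=
    ⟨h1.1, fun x hx y hy p q hp hq hpq => (Real.exp_monotone (h1.2 hx hy hp hq hpq)).trans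
      (convexOn_exp.2 (Set.mem_univ _) (Set.mem_univ _) hp hq hpq)⟩
  refine h2.congr fun x hx => ?_
  simp only [Function.comp_apply]
  rw [Real.rpow_def_of_pos hx, mul_comm]

lemma convexOn_sub_rpow_neg {α : ℝ} (hα : 0 ≤ α) (c : ℝ) :
    ConvexOn ℝ (Set.Iio c) fun x : ℝ => (c - x) ^ (-α) := by
  refine ⟨convex_Iio _, fun x hx y hy p q hp hq hpq => ?_⟩
  have := (convexOn_rpow_neg hα).2 (Set.mem_Ioi.2 (sub_pos.2 hx)) (Set.mem_Ioi.2 (sub_pos.2 hy))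
    hp hq hpq
  refine le_trans (le_of_eq ?_) this
  have : c - (p • x + q • y) = p • (c - x) + q • (c - y) := by
    simp only [smul_eq_mul]
    linear_combination (-c) * hpq
  simp only [this]

lemma monotoneOn_sub_rpow_neg {α : ℝ} (hα : 0 ≤ α) (c : ℝ) :
    MonotoneOn (fun x : ℝ => (c - x) ^ (-α)) (Set.Iio c) := fun x hx y hy hxy =>
  Real.rpow_le_rpow_of_nonpos (sub_pos.2 hy) (by linarith) (by linarith)

lemma continuousOn_sub_rpow_neg (α c : ℝ) :
    ContinuousOn (fun x : ℝ => (c - x) ^ (-α)) (Set.Iio c) :=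
  ContinuousOn.rpow_const (by fun_prop) fun x hx => Or.inl (sub_pos.2 hx).ne'

lemma intervalIntegrable_sub_rpow_neg {α : ℝ} (hα : α < 1) (c a b : ℝ) :
    IntervalIntegrable (fun x : ℝ => (c - x) ^ (-α)) volume a b := by
  have h : IntervalIntegrable (fun x : ℝ => x ^ (-α)) volume (c - a) (c - b) :=
    intervalIntegral.intervalIntegrable_rpow' (by linarith)
  simpa using h.comp_sub_left c

lemma integral_sub_rpow_neg {α : ℝ} (hα : α < 1) (a c : ℝ) :
    ∫ x in a..c, (c - x) ^ (-α) = (c - a) ^ (1 - α) / (1 - α) := by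
  rw [intervalIntegral.integral_comp_sub_left (fun x => x ^ (-α)), sub_self,
    integral_rpow (Or.inl (by linarith)), show -α + 1 = 1 - α by ring,
    Real.zero_rpow (by linarith), sub_zero]

/-- The Beta integral `∫_0^c (c - x)^{-α} x^{α - 1} dx`. -/
lemma integral_sub_rpow_neg_mul_rpow {α c : ℝ} (hα : 0 < α) (hα1 : α < 1) (hc : 0 < c) :
    IntervalIntegrable (fun x : ℝ => (c - x) ^ (-α) * x ^ (α - 1)) volume 0 c ∧
    ∫ x in (0 : ℝ)..c, (c - x) ^ (-α) * x ^ (α - 1) = Real.Gamma α * Real.Gamma (1 - α) := by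
  have hcast : ∀ x ∈ Set.Icc 0 c, (((c - x) ^ (-α) * x ^ (α - 1) : ℝ) : ℂ)
      = (x : ℂ) ^ ((α : ℂ) - 1) * ((c : ℂ) - x) ^ (((1 - α : ℝ) : ℂ) - 1) := fun x hx => by
    rw [Complex.ofReal_mul, Complex.ofReal_cpow (by linarith [hx.2]), Complex.ofReal_cpow hx.1]
    push_cast
    rw [mul_comm]
    congr 2
    ring
  have hval : ∫ x in (0 : ℝ)..c, (((c - x) ^ (-α) * x ^ (α - 1) : ℝ) : ℂ)
      = ((Real.Gamma α * Real.Gamma (1 - α) : ℝ) : ℂ) := by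
    rw [intervalIntegral.integral_congr (g := fun x : ℝ =>
      (x : ℂ) ^ ((α : ℂ) - 1) * ((c : ℂ) - x) ^ (((1 - α : ℝ) : ℂ) - 1))
      (fun x hx => hcast x (by rwa [Set.uIcc_of_le hc.le] at hx)),
      Complex.betaIntegral_scaled _ _ hc]
    have hG := Complex.Gamma_mul_Gamma_eq_betaIntegral (s := (α : ℂ)) (t := ((1 - α : ℝ) : ℂ))
      (by simpa using hα) (by simpa using hα1)
    have h1 : (α : ℂ) + ((1 - α : ℝ) : ℂ) = 1 := by push_cast; ring
    rw [h1] at hG ⊢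
    rw [Complex.Gamma_one, one_mul] at hG
    rw [← hG, sub_self, Complex.cpow_zero, one_mul, Complex.Gamma_ofReal, Complex.Gamma_ofReal]
    push_cast
    rfl
  rw [intervalIntegral.integral_ofReal] at hval
  have hval' := Complex.ofReal_injective hval
  refine ⟨?_, hval'⟩
  -- A non-integrable function has integral `0` by convention, whereas the computed value is
  -- positive.
  by_contra hni
  rw [intervalIntegral.integral_undef hni] at hval'
  have h1 := Real.Gamma_pos_of_pos hα
  have h2 := Real.Gamma_pos_of_pos (sub_pos.2 hα1)
  have := mul_pos h1 h2
  linarith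

end FracNonlocal

namespace FracNonlocal.TimeParams

variable {m : ℕ} (P : TimeParams m)

/-! ## The graded mesh -/

lemma t_zero : P.t 0 = 0 := by
  have := P.one_le_r
  simp [t, Real.zero_rpow (by linarith : P.r ≠ 0)]

lemma t_strictMono (hN : 1 ≤ P.N) : StrictMono P.t := fun i j hij => by
  have hN' : (0 : ℝ) < P.N := by exact_mod_cast hN
  have hij' : (i : ℝ) < j := by exact_mod_cast hij
  have := P.one_le_r
  exact mul_lt_mul_of_pos_left (Real.rpow_lt_rpow (by positivity)
    (div_lt_div_of_pos_right hij' hN') (by linarith)) P.T_pos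

lemma t_N (hN : 1 ≤ P.N) : P.t P.N = P.T := by
  have hN' : (P.N : ℝ) ≠ 0 := by exact_mod_cast (by omega : P.N ≠ 0)
  simp [t, div_self hN']

lemma t_nonneg (hN : 1 ≤ P.N) (n : ℕ) : 0 ≤ P.t n := by
  rw [← P.t_zero]; exact (P.t_strictMono hN).monotone (Nat.zero_le n)

lemma t_lt_t_add_one (hN : 1 ≤ P.N) (n : ℕ) : P.t n < P.t (n + 1) :=
  P.t_strictMono hN (Nat.lt_succ_self n)

lemma τ_pos (hN : 1 ≤ P.N) {n : ℕ} (hn : 1 ≤ n) : 0 < P.τ n :=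
  sub_pos.2 (P.t_strictMono hN (by omega))

/-- The step sizes of the graded mesh are nondecreasing. -/
lemma t_add_one_sub_le (i : ℕ) : P.t (i + 1) - P.t i ≤ P.t (i + 2) - P.t (i + 1) := by
  have hconv := (convexOn_rpow P.one_le_r).2
    (Set.mem_Ici.2 (show 0 ≤ (i : ℝ) / P.N by positivity))
    (Set.mem_Ici.2 (show 0 ≤ ((i + 2 : ℕ) : ℝ) / P.N by positivity))
    (show (0 : ℝ) ≤ 1 / 2 by norm_num) (show (0 : ℝ) ≤ 1 / 2 by norm_num) (by norm_num)
  have e : (1 / 2 : ℝ) • ((i : ℝ) / P.N) + (1 / 2 : ℝ) • (((i + 2 : ℕ) : ℝ) / P.N)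
      = ((i + 1 : ℕ) : ℝ) / P.N := by
    simp only [smul_eq_mul]; push_cast; ring
  rw [e] at hconv
  simp only [smul_eq_mul] at hconv
  have := mul_le_mul_of_nonneg_left hconv P.T_pos.le
  simp only [t]
  linarith

/-! ## The parameter `σ*` -/

lemma two_sub_α_pos (s : Fin m) : 0 < 2 - P.α s := by linarith [P.α_lt_one s]

lemma one_sub_α_pos (s : Fin m) : 0 < 1 - P.α s := by linarith [P.α_lt_one s]

lemma half_le_iInf [NeZero m] : 1 / 2 ≤ ⨅ s, (1 - P.α s / 2) :=
  le_ciInf fun s => by linarith [P.α_lt_one s]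

lemma iSup_le_one [NeZero m] : ⨆ s, (1 - P.α s / 2) ≤ 1 :=
  ciSup_le fun s => by linarith [P.α_pos s]

/-- All summands of `G` are nonpositive at the left end and nonnegative at the right end, so a root
exists. The root set is compact, hence contains its infimum; uniqueness plays no role. -/
lemma σStar_mem_and_G_eq_zero [NeZero m] {n : ℕ} (hτ : 0 < P.τ n) :
    P.σStar n ∈ Set.Icc (⨅ s, (1 - P.α s / 2)) (⨆ s, (1 - P.α s / 2)) ∧
      P.G n (P.σStar n) = 0 := by
  set b₁ := ⨅ s, (1 - P.α s / 2)
  set b₂ := ⨆ s, (1 - P.α s / 2)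
  have hb₁ : 0 < b₁ := lt_of_lt_of_le (by norm_num) P.half_le_iInf
  have hle₁ : ∀ s, b₁ ≤ 1 - P.α s / 2 := fun s => ciInf_le (Set.finite_range _).bddBelow s
  have hle₂ : ∀ s, 1 - P.α s / 2 ≤ b₂ := fun s => le_ciSup (f := fun s => 1 - P.α s / 2)
    (Set.finite_range _).bddAbove s
  have hb : b₁ ≤ b₂ := (hle₁ 0).trans (hle₂ 0)
  have hcont : ContinuousOn (P.G n) (Set.Icc b₁ b₂) := by
    unfold G
    refine continuousOn_finsetSum _ fun s _ => ?_
    refine ((continuousOn_const.mul ?_).mul (by fun_prop)).mul continuousOn_const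
    exact ContinuousOn.rpow_const continuousOn_id fun x hx =>
      Or.inl (hb₁.trans_le hx.1).ne'
  have hcoef : ∀ s x, 0 ≤ x → 0 ≤ P.μ s / Real.Gamma (3 - P.α s) * x ^ (1 - P.α s) :=
    fun s x hx => mul_nonneg (div_nonneg (P.μ_pos s).le
      (Real.Gamma_pos_of_pos (by linarith [P.α_lt_one s])).le) (Real.rpow_nonneg hx _)
  have h1 : P.G n b₁ ≤ 0 := Finset.sum_nonpos fun s _ =>
    mul_nonpos_of_nonpos_of_nonneg (mul_nonpos_of_nonneg_of_nonpos (hcoef s b₁ hb₁.le)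
      (sub_nonpos.2 (hle₁ s))) (Real.rpow_nonneg hτ.le _)
  have h2 : 0 ≤ P.G n b₂ := Finset.sum_nonneg fun s _ =>
    mul_nonneg (mul_nonneg (hcoef s b₂ (hb₁.le.trans hb))
      (sub_nonneg.2 (hle₂ s))) (Real.rpow_nonneg hτ.le _)
  obtain ⟨x, hx, hx0⟩ := intermediate_value_Icc hb hcont ⟨h1, h2⟩
  have hcomp : IsCompact {x | x ∈ Set.Icc b₁ b₂ ∧ P.G n x = 0} := by
    have : {x | x ∈ Set.Icc b₁ b₂ ∧ P.G n x = 0} = Set.Icc b₁ b₂ ∩ P.G n ⁻¹' {0} := rfl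
    rw [this]
    exact isCompact_Icc.of_isClosed_subset
      (hcont.preimage_isClosed_of_isClosed isClosed_Icc isClosed_singleton) Set.inter_subset_left
  exact hcomp.sInf_mem ⟨x, hx, hx0⟩

lemma half_le_σStar [NeZero m] {n : ℕ} (hτ : 0 < P.τ n) : 1 / 2 ≤ P.σStar n :=
  P.half_le_iInf.trans (P.σStar_mem_and_G_eq_zero hτ).1.1

lemma σStar_le_one [NeZero m] {n : ℕ} (hτ : 0 < P.τ n) : P.σStar n ≤ 1 :=
  (P.σStar_mem_and_G_eq_zero hτ).1.2.trans P.iSup_le_one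

lemma tσ_eq (n : ℕ) : P.tσ n = P.t (n - 1) + P.σStar n * P.τ n := by
  simp only [tσ, σ, τ]; ring

lemma t_pred_lt_tσ [NeZero m] {n : ℕ} (hτ : 0 < P.τ n) : P.t (n - 1) < P.tσ n := by
  have := mul_pos (lt_of_lt_of_le (by norm_num) (P.half_le_σStar hτ)) hτ
  rw [tσ_eq]; linarith

lemma tσ_le_t [NeZero m] {n : ℕ} (hτ : 0 < P.τ n) : P.tσ n ≤ P.t n := by
  have := mul_le_mul_of_nonneg_right (P.σStar_le_one hτ) hτ.le
  rw [tσ_eq]; simp only [τ] at *; linarith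

/-- `x^{1 - α_s} / Γ(2 - α_s)` with `x = σ*_n τ_n`: the integral of the `s`-th kernel over
`[t_{n-1}, t_{n-σ_n}]`. -/
noncomputable def lastWeight (s : Fin m) (n : ℕ) : ℝ :=
  (P.σStar n * P.τ n) ^ (1 - P.α s) / Real.Gamma (2 - P.α s)

lemma lastWeight_nonneg [NeZero m] (s : Fin m) {n : ℕ} (hτ : 0 < P.τ n) :
    0 ≤ P.lastWeight s n :=
  div_nonneg (Real.rpow_nonneg (mul_nonneg (by linarith [P.half_le_σStar hτ]) hτ.le) _)
    (Real.Gamma_pos_of_pos (P.two_sub_α_pos s)).le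

lemma Gamma_two_sub (s : Fin m) :
    Real.Gamma (2 - P.α s) = (1 - P.α s) * Real.Gamma (1 - P.α s) := by
  rw [← Real.Gamma_add_one (P.one_sub_α_pos s).ne']; congr 1; ring

/-- The equation `𝒢_n(σ*_n) = 0`, written with the weights of the last subinterval. -/
lemma sum_lastWeight_eq_zero [NeZero m] {n : ℕ} (hτ : 0 < P.τ n) :
    ∑ s, P.μ s * P.lastWeight s n * (P.σStar n / (2 - P.α s) - 1 / 2) = 0 := by
  have hG := (P.σStar_mem_and_G_eq_zero hτ).2
  have hθ : 0 < P.σStar n := lt_of_lt_of_le (by norm_num) (P.half_le_σStar hτ)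
  have h : P.G n (P.σStar n) =
      P.τ n * ∑ s, P.μ s * P.lastWeight s n * (P.σStar n / (2 - P.α s) - 1 / 2) := by
    rw [G, Finset.mul_sum]
    refine Finset.sum_congr rfl fun s _ => ?_
    have h3 : Real.Gamma (3 - P.α s) = (2 - P.α s) * Real.Gamma (2 - P.α s) := by
      rw [← Real.Gamma_add_one (P.two_sub_α_pos s).ne']; congr 1; ring
    have h4 : P.τ n ^ (2 - P.α s) = P.τ n ^ (1 - P.α s) * P.τ n := by
      rw [← Real.rpow_add_one hτ.ne']; congr 1; ring
    have h5 := (Real.Gamma_pos_of_pos (P.two_sub_α_pos s)).ne'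
    have h6 := (P.two_sub_α_pos s).ne'
    rw [h3, h4, lastWeight, Real.mul_rpow hθ.le hτ.le]
    field_simp
  rw [h] at hG
  exact (mul_eq_zero.1 hG).resolve_left hτ.ne'

/-! ## The single-term coefficients -/

lemma Gamma_one_sub_pos (s : Fin m) : 0 < Real.Gamma (1 - P.α s) :=
  Real.Gamma_pos_of_pos (P.one_sub_α_pos s)

lemma Icc_subset_Iio [NeZero m] (hN : 1 ≤ P.N) {n i j : ℕ} (hj : j < n) :
    Set.Icc (P.t i) (P.t j) ⊆ Set.Iio (P.tσ n) := fun _ hx =>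
  hx.2.trans_lt (((P.t_strictMono hN).monotone (by omega)).trans_lt
    (P.t_pred_lt_tσ (P.τ_pos hN (by omega))))

lemma bCoef_nonneg [NeZero m] (hN : 1 ≤ P.N) (s : Fin m) {n j : ℕ} (hj : j < n) :
    0 ≤ P.bCoef s n j := by
  have hsub := P.Icc_subset_Iio hN (i := j - 1) hj
  have h1 := (P.t_strictMono hN).monotone (show j - 1 ≤ j by omega)
  have h2 := (P.t_strictMono hN).monotone (show j ≤ j + 1 by omega)
  have := (P.Gamma_one_sub_pos s).le
  refine mul_nonneg (div_nonneg zero_le_two (mul_nonneg this (by linarith))) ?_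
  exact integral_mul_sub_midpoint_nonneg h1 ((continuousOn_sub_rpow_neg _ _).mono hsub)
    ((monotoneOn_sub_rpow_neg (P.α_pos s).le _).mono hsub)

lemma gSingle_of_lt (s : Fin m) {n j : ℕ} (hj : 1 ≤ j) (hjn : j < n) :
    P.gSingle s n j = (P.τ j)⁻¹ *
      (P.aCoef s n j + (if j = 1 then 0 else P.bCoef s n (j - 1)) - P.bCoef s n j) := by
  unfold gSingle
  rw [if_neg (by omega), if_neg (by omega : ¬ j = n)]
  split_ifs <;> ring

lemma gSingle_self (s : Fin m) (n : ℕ) :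
    P.gSingle s n n = (P.τ n)⁻¹ *
      (P.aCoef s n n + (if n = 1 then 0 else P.bCoef s n (n - 1))) := by
  unfold gSingle
  split_ifs <;> simp_all

lemma aCoef_self (s : Fin m) (n : ℕ) : P.aCoef s n n = P.lastWeight s n := by
  have h1 := (P.Gamma_one_sub_pos s).ne'
  have h2 := (P.one_sub_α_pos s).ne'
  rw [aCoef, if_pos rfl, integral_sub_rpow_neg (P.α_lt_one s), lastWeight, Gamma_two_sub, tσ_eq]
  simp only [add_sub_cancel_left]
  field_simp

lemma lastWeight_le_gSingle_self [NeZero m] (hN : 1 ≤ P.N) (s : Fin m) {n : ℕ} (hn : 1 ≤ n) :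
    (P.τ n)⁻¹ * P.lastWeight s n ≤ P.gSingle s n n := by
  rw [gSingle_self, aCoef_self]
  refine mul_le_mul_of_nonneg_left ?_ (inv_pos.2 (P.τ_pos hN hn)).le
  split_ifs
  · simp
  · linarith [P.bCoef_nonneg hN s (show n - 1 < n by omega)]

/-- Steps do not decrease, so `t_{j+1} - t_{j-1} ≥ 2 τ_j`. This supplies the slope `β` of the
averaging lemmas. -/
lemma bCoef_stepSize [NeZero m] (hN : 1 ≤ P.N) {j : ℕ} (hj : 1 ≤ j) :
    0 ≤ 2 / (P.t (j + 1) - P.t (j - 1)) ∧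
      2 / (P.t (j + 1) - P.t (j - 1)) * (P.t j - P.t (j - 1)) ≤ 1 := by
  have h1 : P.t (j - 1) < P.t j := P.t_strictMono hN (by omega)
  have h2 := P.t_lt_t_add_one hN j
  have h3 := P.t_add_one_sub_le (j - 1)
  rw [show j - 1 + 1 = j by omega, show j - 1 + 2 = j + 1 by omega] at h3
  have h4 : 0 < P.t (j + 1) - P.t (j - 1) := by linarith
  refine ⟨by positivity, ?_⟩
  rw [div_mul_eq_mul_div, div_le_one h4]
  linarith

lemma gSingle_ge_of_lt [NeZero m] (hN : 1 ≤ P.N) (s : Fin m) {n j : ℕ} (hj : 1 ≤ j)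
    (hjn : j < n) {c : ℝ}
    (hc : c ≤ (∫ η in P.t (j - 1)..P.t j, (P.tσ n - η) ^ (-P.α s))
      - 2 / (P.t (j + 1) - P.t (j - 1)) * ∫ η in P.t (j - 1)..P.t j,
        (P.tσ n - η) ^ (-P.α s) * (η - (P.t (j - 1) + P.t j) / 2)) :
    (P.τ j)⁻¹ * (c / Real.Gamma (1 - P.α s)) ≤ P.gSingle s n j := by
  rw [gSingle_of_lt P s hj hjn]
  refine mul_le_mul_of_nonneg_left ?_ (inv_pos.2 (P.τ_pos hN hj)).le
  have hΓ := P.Gamma_one_sub_pos s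
  have hb : 0 ≤ if j = 1 then 0 else P.bCoef s n (j - 1) := by
    split_ifs
    · exact le_rfl
    · exact P.bCoef_nonneg hN s (by omega)
  have h := div_le_div_of_nonneg_right hc hΓ.le
  refine h.trans ?_
  have : P.aCoef s n j - P.bCoef s n j = ((∫ η in P.t (j - 1)..P.t j, (P.tσ n - η) ^ (-P.α s))
      - 2 / (P.t (j + 1) - P.t (j - 1)) * ∫ η in P.t (j - 1)..P.t j,
        (P.tσ n - η) ^ (-P.α s) * (η - (P.t (j - 1) + P.t j) / 2)) / Real.Gamma (1 - P.α s) := by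
    rw [aCoef, bCoef, if_neg (by omega)]
    rw [← div_div, div_right_comm]
    ring
  linarith

lemma kernel_le_gSingle [NeZero m] (hN : 1 ≤ P.N) (s : Fin m) {n j : ℕ} (hj : 1 ≤ j)
    (hjn : j < n) :
    (P.tσ n - P.t (j - 1)) ^ (-P.α s) / Real.Gamma (1 - P.α s) ≤ P.gSingle s n j := by
  have hsub := P.Icc_subset_Iio hN (i := j - 1) hjn
  have h1 : P.t (j - 1) < P.t j := P.t_strictMono hN (by omega)
  have hβ := P.bCoef_stepSize hN hj
  have hmono := (monotoneOn_sub_rpow_neg (P.α_pos s).le (P.tσ n)).mono hsub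
  have h := P.gSingle_ge_of_lt hN s hj hjn (le_integral_sub_integral_mul_sub_midpoint h1.le
    ((continuousOn_sub_rpow_neg (P.α s) _).mono hsub) (by linarith) hβ.1
    (fun η hη => hmono (Set.left_mem_Icc.2 h1.le) hη hη.1))
  have hτ : P.t j - P.t (j - 1) ≠ 0 := (sub_pos.2 h1).ne'
  refine le_trans (le_of_eq ?_) h
  rw [τ, mul_div_assoc, inv_mul_cancel_left₀ hτ]

/-- The lower bound used for the barrier, with the kernel centred at `t_n ≥ tσ n` so that the pieces
join into one Beta integral. The factor `1/2` pays for the `b` term when `j < n`, and for `σ*^(1-α)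
≥ σ* ≥ 1/2` when `j = n`. -/
lemma half_average_le_gSingle [NeZero m] (hN : 1 ≤ P.N) (s : Fin m) {n j : ℕ} (hj : 1 ≤ j)
    (hjn : j ≤ n) :
    (P.τ j)⁻¹ * ((∫ η in P.t (j - 1)..P.t j, (P.t n - η) ^ (-P.α s)) / 2
      / Real.Gamma (1 - P.α s)) ≤ P.gSingle s n j := by
  have h1 : P.t (j - 1) < P.t j := P.t_strictMono hN (by omega)
  have hτn := P.τ_pos hN (hj.trans hjn)
  rcases hjn.lt_or_eq with hjn | rfl
  · have hsub := P.Icc_subset_Iio hN (i := j - 1) hjn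
    have hβ := P.bCoef_stepSize hN hj
    have hcont := (continuousOn_sub_rpow_neg (P.α s) (P.tσ n)).mono hsub
    refine P.gSingle_ge_of_lt hN s hj hjn (le_trans ?_
      (half_integral_le_integral_sub_integral_mul_sub_midpoint h1.le hcont hβ.2 hβ.1
        (fun η hη => Real.rpow_nonneg (sub_nonneg.2 (hsub hη).le) _)))
    have := intervalIntegral.integral_mono_on h1.le
      (intervalIntegrable_sub_rpow_neg (P.α_lt_one s) (P.t n) _ _)
      (hcont.intervalIntegrable_of_Icc h1.le) (fun η hη =>
        Real.rpow_le_rpow_of_nonpos (sub_pos.2 (hsub hη)) (sub_le_sub_right (P.tσ_le_t hτn) _)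
          (neg_nonpos.2 (P.α_pos s).le))
    linarith
  · refine le_trans ?_ (P.lastWeight_le_gSingle_self hN s hj)
    refine mul_le_mul_of_nonneg_left ?_ (inv_pos.2 hτn).le
    rw [integral_sub_rpow_neg (P.α_lt_one s), lastWeight, Gamma_two_sub]
    have hθ := P.half_le_σStar hτn
    have hθ1 := P.σStar_le_one hτn
    have hp : 1 / 2 ≤ P.σStar j ^ (1 - P.α s) := by
      refine hθ.trans ?_
      have := Real.rpow_le_rpow_of_exponent_ge (by linarith) hθ1
        (by linarith [P.α_pos s] : 1 - P.α s ≤ 1)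
      rwa [Real.rpow_one] at this
    have hΓ := P.Gamma_one_sub_pos s
    have hα := P.one_sub_α_pos s
    have hq := Real.rpow_nonneg hτn.le (1 - P.α s)
    rw [Real.mul_rpow (by linarith) hτn.le]
    change P.τ j ^ (1 - P.α s) / (1 - P.α s) / 2 / Real.Gamma (1 - P.α s) ≤ _
    rw [show P.τ j ^ (1 - P.α s) / (1 - P.α s) / 2 / Real.Gamma (1 - P.α s)
      = 1 / 2 * P.τ j ^ (1 - P.α s) / ((1 - P.α s) * Real.Gamma (1 - P.α s)) by field_simp]
    exact div_le_div_of_nonneg_right (mul_le_mul_of_nonneg_right hp hq) (by positivity)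

lemma gSingle_le_kernel [NeZero m] (hN : 1 ≤ P.N) (s : Fin m) {n j : ℕ} (hj : 1 ≤ j)
    (hjn : j < n) :
    P.gSingle s n j ≤ (P.tσ n - P.t j) ^ (-P.α s) / Real.Gamma (1 - P.α s) := by
  have hτ := P.τ_pos hN hj
  have hΓ := P.Gamma_one_sub_pos s
  have hb := P.bCoef_nonneg hN s hjn
  have h1 : P.t (j - 1) < P.t j := P.t_strictMono hN (by omega)
  rw [gSingle_of_lt P s hj hjn, inv_mul_le_iff₀ hτ]
  have key : P.aCoef s n j + (if j = 1 then 0 else P.bCoef s n (j - 1)) ≤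
      P.τ j * ((P.tσ n - P.t j) ^ (-P.α s) / Real.Gamma (1 - P.α s)) := by
    have hsub1 := P.Icc_subset_Iio hN (i := j - 1) hjn
    have hmono := (monotoneOn_sub_rpow_neg (P.α_pos s).le (P.tσ n)).mono hsub1
    rw [aCoef, if_neg (by omega : ¬ j = n), ← mul_div_assoc, le_div_iff₀ hΓ]
    split_ifs with hj1
    · have h := intervalIntegral.integral_mono_on h1.le
        (intervalIntegrable_sub_rpow_neg (P.α_lt_one s) (P.tσ n) _ _)
        (intervalIntegrable_const (c := (P.tσ n - P.t j) ^ (-P.α s)))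
        (fun η hη => hmono hη (Set.right_mem_Icc.2 h1.le) hη.2)
      rw [intervalIntegral.integral_const, smul_eq_mul] at h
      refine le_trans (le_of_eq ?_) h
      field_simp
      ring
    -- The term `b_{n,j-1}` lives on the preceding interval, so the convexity estimate is applied on
    -- `[t_i, t_{i+2}]`.
    · obtain ⟨i, rfl⟩ : ∃ i, j = i + 2 := ⟨j - 2, by omega⟩
      rw [bCoef]
      simp only [show i + 2 - 1 = i + 1 by omega, show i + 1 + 1 = i + 2 by omega,
        Nat.add_sub_cancel] at *
      have hsub := P.Icc_subset_Iio hN (i := i) hjn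
      have h := integral_add_integral_mul_sub_midpoint_le (P.t_lt_t_add_one hN i) h1
        (P.t_add_one_sub_le i) ((continuousOn_sub_rpow_neg (P.α s) (P.tσ n)).mono hsub)
        ((convexOn_sub_rpow_neg (P.α_pos s).le (P.tσ n)).subset hsub (convex_Icc _ _))
        (hmono (Set.left_mem_Icc.2 h1.le) (Set.right_mem_Icc.2 h1.le) h1.le)
      have h2 : P.t (i + 2) - P.t i ≠ 0 := by linarith [P.t_lt_t_add_one hN i]
      refine le_trans (le_of_eq ?_) h
      field_simp
  linarith

/-! ## The multi-term coefficients -/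

lemma g_pos [NeZero m] (hN : 1 ≤ P.N) {n j : ℕ} (hj : 1 ≤ j) (hjn : j ≤ n) : 0 < P.g n j := by
  refine Finset.sum_pos (fun s _ => mul_pos (P.μ_pos s) ?_) Finset.univ_nonempty
  rcases hjn.lt_or_eq with hjn | rfl
  · have h := P.Icc_subset_Iio hN (i := j - 1) hjn
      (Set.left_mem_Icc.2 ((P.t_strictMono hN).monotone (show j - 1 ≤ j by omega)))
    exact (div_pos (Real.rpow_pos_of_pos (sub_pos.2 h) _) (P.Gamma_one_sub_pos s)).trans_le
      (P.kernel_le_gSingle hN s hj hjn)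
  · have hτ := P.τ_pos hN hj
    have hθ : 0 < P.σStar j := lt_of_lt_of_le (by norm_num) (P.half_le_σStar hτ)
    refine lt_of_lt_of_le (mul_pos (inv_pos.2 hτ) (div_pos ?_ ?_))
      (P.lastWeight_le_gSingle_self hN s hj)
    · positivity
    · exact Real.Gamma_pos_of_pos (P.two_sub_α_pos s)

/-- This is where the choice of `σ*` enters. Both weights are compared with `lastWeight`; the
equation `𝒢_n(σ*) = 0`, valid only after summing over `s`, replaces `2θ - 1` by `2θ(1-α_s)/(2-α_s)`,
which termwise exceeds the required `θ(1-α_s)` because `2/(2-α_s) ≥ 1`. -/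
lemma σStar_sq_mul_g_le [NeZero m] (hN : 1 ≤ P.N) {n : ℕ} (hn : 2 ≤ n) :
    P.σStar n ^ 2 * P.g n (n - 1) ≤ (2 * P.σStar n - 1) * P.g n n := by
  have hτ := P.τ_pos hN (show 1 ≤ n by omega)
  have hθ := P.half_le_σStar hτ
  set θ := P.σStar n
  have hx : 0 < θ * P.τ n := mul_pos (by linarith) hτ
  have hup : P.g n (n - 1) ≤
      ∑ s, P.μ s * (P.lastWeight s n * (1 - P.α s) / (θ * P.τ n)) := by
    refine Finset.sum_le_sum fun s _ => mul_le_mul_of_nonneg_left ?_ (P.μ_pos s).le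
    refine (P.gSingle_le_kernel hN s (show 1 ≤ n - 1 by omega) (by omega)).trans (le_of_eq ?_)
    have h1 : P.tσ n - P.t (n - 1) = θ * P.τ n := by rw [tσ_eq]; ring
    have h2 : (θ * P.τ n) ^ (1 - P.α s) = (θ * P.τ n) ^ (-P.α s) * (θ * P.τ n) := by
      rw [← Real.rpow_add_one hx.ne']; congr 1; ring
    have hΓ := (P.Gamma_one_sub_pos s).ne'
    have hα := (P.one_sub_α_pos s).ne'
    rw [h1, lastWeight, Gamma_two_sub, h2]
    field_simp
  have hlow : ∑ s, P.μ s * ((P.τ n)⁻¹ * P.lastWeight s n) ≤ P.g n n :=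
    Finset.sum_le_sum fun s _ => mul_le_mul_of_nonneg_left
      (P.lastWeight_le_gSingle_self hN s (by omega)) (P.μ_pos s).le
  refine (mul_le_mul_of_nonneg_left hup (sq_nonneg θ)).trans (le_trans ?_
    (mul_le_mul_of_nonneg_left hlow (by linarith)))
  have hG := P.sum_lastWeight_eq_zero hτ
  have e : (2 * θ - 1) * ∑ s, P.μ s * ((P.τ n)⁻¹ * P.lastWeight s n)
      = ∑ s, (P.μ s * P.lastWeight s n * (P.τ n)⁻¹) * (2 * θ * ((1 - P.α s) / (2 - P.α s))) := by
    have : (0 : ℝ) = 2 * (P.τ n)⁻¹ *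
        ∑ s, P.μ s * P.lastWeight s n * (θ / (2 - P.α s) - 1 / 2) := by rw [hG]; ring
    rw [← sub_zero ((2 * θ - 1) * _), this, Finset.mul_sum, Finset.mul_sum,
      ← Finset.sum_sub_distrib]
    refine Finset.sum_congr rfl fun s _ => ?_
    have h6 := (P.two_sub_α_pos s).ne'
    field_simp
    ring
  rw [e, Finset.mul_sum]
  refine Finset.sum_le_sum fun s _ => ?_
  have hw := P.lastWeight_nonneg s hτ
  have hμ := (P.μ_pos s).le
  have h2 := P.two_sub_α_pos s
  have h1 := P.one_sub_α_pos s
  have e2 : θ ^ 2 * (P.μ s * (P.lastWeight s n * (1 - P.α s) / (θ * P.τ n)))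
      = (P.μ s * P.lastWeight s n * (P.τ n)⁻¹) * (θ * (1 - P.α s)) := by
    have : θ ≠ 0 := by linarith
    field_simp
  rw [e2]
  refine mul_le_mul_of_nonneg_left ?_ (by positivity)
  rw [show 2 * θ * ((1 - P.α s) / (2 - P.α s)) = θ * (1 - P.α s) * (2 / (2 - P.α s)) by ring]
  refine le_mul_of_one_le_right (mul_nonneg (by linarith) h1.le) ?_
  rw [one_le_div h2]
  linarith [P.α_pos s]

lemma g_mono [NeZero m] (hN : 1 ≤ P.N) {n j : ℕ} (hj : 1 ≤ j) (hjn : j < n) :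
    P.g n j ≤ P.g n (j + 1) := by
  rcases (show j + 1 < n ∨ j + 1 = n by omega) with h | rfl
  · refine Finset.sum_le_sum fun s _ => mul_le_mul_of_nonneg_left ?_ (P.μ_pos s).le
    have h1 := P.kernel_le_gSingle hN s (show 1 ≤ j + 1 by omega) h
    rw [Nat.add_sub_cancel] at h1
    exact (P.gSingle_le_kernel hN s hj hjn).trans h1
  -- The last comparison follows from `2θ - 1 ≤ θ²`.
  · have h := P.σStar_sq_mul_g_le hN (show 2 ≤ j + 1 by omega)
    have hθ := P.half_le_σStar (P.τ_pos hN (show 1 ≤ j + 1 by omega))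
    simp only [Nat.add_sub_cancel] at h
    have hg := (P.g_pos hN (show 1 ≤ j + 1 by omega) le_rfl).le
    refine le_of_mul_le_mul_left (h.trans (mul_le_mul_of_nonneg_right ?_ hg))
      (pow_pos (by linarith : 0 < P.σStar (j + 1)) 2)
    linarith [sq_nonneg (P.σStar (j + 1) - 1)]

/-! ## The barrier function -/

/-- `w(t) = t^{α_1} / (μ_1 Γ(1 + α_1))`, whose fractional derivative is at least `1`. -/
noncomputable def barrier [NeZero m] (x : ℝ) : ℝ := x ^ P.α 0 / (P.μ 0 * Real.Gamma (1 + P.α 0))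

lemma barrier_sub [NeZero m] {x y : ℝ} :
    P.barrier y - P.barrier x =
      (∫ η in x..y, η ^ (P.α 0 - 1)) / (P.μ 0 * Real.Gamma (P.α 0)) := by
  have hα := P.α_pos 0
  have h1 := (Real.Gamma_pos_of_pos hα).ne'
  have h2 := (P.μ_pos 0).ne'
  rw [integral_rpow (Or.inl (by linarith)), barrier, barrier, add_comm 1 (P.α 0),
    Real.Gamma_add_one hα.ne', sub_add_cancel]
  field_simp

/-- On each interval the kernel increases and `η^(α-1)` decreases, so by Chebyshev the product of
their averages dominates the average of their product. Summation yields the Beta integral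
`Γ(α)Γ(1-α)`, which cancels the normalization up to the `1/2` of `half_average_le_gSingle`. -/
lemma half_le_sum_barrier [NeZero m] (hN : 1 ≤ P.N) {n : ℕ} (hn : 1 ≤ n) :
    1 / 2 ≤ ∑ j ∈ Finset.Icc 1 n,
      P.g n j * (P.barrier (P.t j) - P.barrier (P.t (j - 1))) := by
  set α := P.α 0
  have hα : 0 < α := P.α_pos 0
  have hα1 : α < 1 := P.α_lt_one 0
  have hμ := P.μ_pos 0
  have hΓ := Real.Gamma_pos_of_pos hα
  have hΓ1 : 0 < Real.Gamma (1 - α) := P.Gamma_one_sub_pos 0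
  have htn : 0 < P.t n := by rw [← P.t_zero]; exact P.t_strictMono hN (by omega)
  obtain ⟨hint, hval⟩ := integral_sub_rpow_neg_mul_rpow hα hα1 htn
  have hmono := (P.t_strictMono hN).monotone
  have hintj : ∀ i < n, IntervalIntegrable (fun x : ℝ => (P.t n - x) ^ (-α) * x ^ (α - 1))
      volume (P.t i) (P.t (i + 1)) := fun i hi => by
    refine hint.mono_set ?_
    rw [Set.uIcc_of_le (hmono (Nat.le_succ i)), Set.uIcc_of_le htn.le]
    exact Set.Icc_subset_Icc (P.t_nonneg hN i) (hmono (by omega))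
  have hterm : ∀ i < n, (∫ x in P.t i..P.t (i + 1), (P.t n - x) ^ (-α) * x ^ (α - 1))
      / (2 * (Real.Gamma α * Real.Gamma (1 - α))) ≤
      P.g n (i + 1) * (P.barrier (P.t (i + 1)) - P.barrier (P.t i)) := fun i hi => by
    have hlt := P.t_lt_t_add_one hN i
    have hi0 := P.t_nonneg hN i
    have hin : P.t (i + 1) ≤ P.t n := hmono (by omega)
    have hcheb := integral_mul_le_of_monotoneOn_antitoneOn (k := fun x => (P.t n - x) ^ (-α))
      (h := fun x => x ^ (α - 1)) hlt.le
      ((monotoneOn_sub_rpow_neg hα.le (P.t n)).mono fun x hx => hx.2.trans_le hin)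
      (fun x hx y hy hxy => Real.rpow_le_rpow_of_nonpos (hi0.trans_lt hx.1) hxy (by linarith))
      (intervalIntegrable_sub_rpow_neg hα1 _ _ _)
      (intervalIntegral.intervalIntegrable_rpow' (by linarith)) (hintj i hi)
    have hτ : 0 < P.t (i + 1) - P.t i := sub_pos.2 hlt
    have hH : 0 ≤ ∫ η in P.t i..P.t (i + 1), η ^ (α - 1) :=
      intervalIntegral.integral_nonneg hlt.le fun x hx => Real.rpow_nonneg (hi0.trans hx.1) _
    -- Only the term of highest order is kept; the others are nonnegative.
    have hg : P.μ 0 * ((P.t (i + 1) - P.t i)⁻¹ *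
        ((∫ η in P.t i..P.t (i + 1), (P.t n - η) ^ (-α)) / 2 / Real.Gamma (1 - α)))
        ≤ P.g n (i + 1) := by
      have h0 := P.half_average_le_gSingle hN 0 (show 1 ≤ i + 1 by omega) (show i + 1 ≤ n from hi)
      refine (mul_le_mul_of_nonneg_left h0 hμ.le).trans ?_
      refine Finset.single_le_sum (f := fun s => P.μ s * P.gSingle s n (i + 1))
        (fun s _ => mul_nonneg (P.μ_pos s).le ?_) (Finset.mem_univ 0)
      refine le_trans ?_ (P.half_average_le_gSingle hN s (show 1 ≤ i + 1 by omega) hi)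
      refine mul_nonneg (inv_pos.2 hτ).le (div_nonneg (div_nonneg ?_ zero_le_two)
        (P.Gamma_one_sub_pos s).le)
      exact intervalIntegral.integral_nonneg hlt.le fun x hx =>
        Real.rpow_nonneg (sub_nonneg.2 (hx.2.trans hin)) _
    rw [barrier_sub]
    refine le_trans ?_ (mul_le_mul_of_nonneg_right hg (div_nonneg hH (by positivity)))
    rw [div_le_iff₀ (by positivity)]
    set A := ∫ η in P.t i..P.t (i + 1), (P.t n - η) ^ (-α)
    set B := ∫ η in P.t i..P.t (i + 1), η ^ (α - 1)
    have e : P.μ 0 * ((P.t (i + 1) - P.t i)⁻¹ * (A / 2 / Real.Gamma (1 - α))) *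
        (B / (P.μ 0 * Real.Gamma α)) * (2 * (Real.Gamma α * Real.Gamma (1 - α)))
        = A * B / (P.t (i + 1) - P.t i) := by
      field_simp
    rw [e, le_div_iff₀ hτ, mul_comm]
    exact hcheb
  have hsum := intervalIntegral.sum_integral_adjacent_intervals hintj
  rw [P.t_zero, hval] at hsum
  have e : ∑ j ∈ Finset.Icc 1 n, P.g n j * (P.barrier (P.t j) - P.barrier (P.t (j - 1)))
      = ∑ i ∈ Finset.range n, P.g n (i + 1) * (P.barrier (P.t (i + 1)) - P.barrier (P.t i)) := by
    rw [Finset.range_eq_Ico]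
    exact (Finset.sum_Ico_add' (fun j => P.g n j * (P.barrier (P.t j) - P.barrier (P.t (j - 1))))
      0 n 1).symm
  rw [e]
  refine le_trans (le_of_eq ?_) (Finset.sum_le_sum fun i hi => hterm i (Finset.mem_range.1 hi))
  rw [← Finset.sum_div, hsum]
  field_simp

end FracNonlocal.TimeParams

/-! ### Stability and coercivity of the discrete fractional derivative -/

namespace FracNonlocal

namespace TimeParams

variable {m : ℕ} (P : TimeParams m)

lemma barrier_nonneg [NeZero m] {x : ℝ} (hx : 0 ≤ x) : 0 ≤ P.barrier x := by
  have h1 := Real.Gamma_pos_of_pos (show 0 < 1 + P.α 0 by linarith [P.α_pos 0])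
  have h2 := P.μ_pos 0
  unfold barrier
  positivity

lemma barrier_mono [NeZero m] {x y : ℝ} (hx : 0 ≤ x) (hxy : x ≤ y) :
    P.barrier x ≤ P.barrier y := by
  have h1 := Real.Gamma_pos_of_pos (show 0 < 1 + P.α 0 by linarith [P.α_pos 0])
  exact div_le_div_of_nonneg_right (Real.rpow_le_rpow hx hxy (P.α_pos 0).le)
    (mul_nonneg (P.μ_pos 0).le h1.le)

/-- Stability of the discrete fractional derivative in the maximum norm. -/
lemma le_add_barrier_of_sum_le [NeZero m] (hN : 1 ≤ P.N) {z : ℕ → ℝ} {M : ℕ} {C : ℝ}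
    (hMN : M ≤ P.N) (hC : 0 ≤ C)
    (hz : ∀ n, 1 ≤ n → n ≤ M → ∑ j ∈ Finset.Icc 1 n, P.g n j * (z j - z (j - 1)) ≤ C) :
    ∀ n ≤ M, z n ≤ z 0 + 2 * C * P.barrier P.T := by
  intro n hn
  have h := le_initial_of_sum_nonpos (g := P.g) (N := M)
    -- The factor `2` offsets the lower bound `1/2` for the discrete derivative of the barrier.
    (z := fun j => z j - 2 * C * P.barrier (P.t j))
    (fun n _ _ j hj hjn => P.g_pos hN hj hjn) (fun n _ _ j hj hjn => P.g_mono hN hj hjn)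
    (fun n hn hnM => by
      have h1 := mul_le_mul_of_nonneg_left (P.half_le_sum_barrier hN hn)
        (mul_nonneg zero_le_two hC)
      have h2 := hz n hn hnM
      rw [Finset.mul_sum] at h1
      have h3 : ∑ j ∈ Finset.Icc 1 n, P.g n j * ((z j - 2 * C * P.barrier (P.t j))
          - (z (j - 1) - 2 * C * P.barrier (P.t (j - 1))))
          = ∑ j ∈ Finset.Icc 1 n, P.g n j * (z j - z (j - 1)) - ∑ j ∈ Finset.Icc 1 n,
            2 * C * (P.g n j * (P.barrier (P.t j) - P.barrier (P.t (j - 1)))) := by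
        rw [← Finset.sum_sub_distrib]
        exact Finset.sum_congr rfl fun j _ => by ring
      rw [h3]
      linarith) n hn
  have hT : P.barrier (P.t n) ≤ P.barrier P.T := by
    rw [← P.t_N hN]
    exact P.barrier_mono (P.t_nonneg hN n) ((P.t_strictMono hN).monotone (hn.trans hMN))
  have h0 : 0 ≤ P.barrier (P.t 0) := P.barrier_nonneg (P.t_nonneg hN 0)
  have h4 := mul_le_mul_of_nonneg_left hT (mul_nonneg zero_le_two hC)
  have h5 := mul_nonneg (mul_nonneg zero_le_two hC) h0
  linarith

/-- The energy inequality for the `L2-1_σ` operator. -/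
lemma half_sum_norm_sq_le_inner_wavg [NeZero m] {H : Type*} [NormedAddCommGroup H]
    [InnerProductSpace ℝ H] (hN : 1 ≤ P.N) (v : ℕ → H) {n : ℕ} (hn : 1 ≤ n) :
    (∑ j ∈ Finset.Icc 1 n, P.g n j * (‖v j‖ ^ 2 - ‖v (j - 1)‖ ^ 2)) / 2 ≤
      inner ℝ (P.wavg v n) (P.DN v n) := by
  have h := half_sum_norm_sq_le_inner (g := P.g n) (v := v) (θ := P.σStar n) hn
    (fun j hj hjn => (P.g_pos hN hj hjn).le) (fun j hj hjn => P.g_mono hN hj hjn)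
    (P.half_le_σStar (P.τ_pos hN hn)) (fun h2 => P.σStar_sq_mul_g_le hN h2)
  simpa [wavg, DN, σ] using h

lemma norm_wavg_le [NeZero m] {H : Type*} [NormedAddCommGroup H]
    [InnerProductSpace ℝ H] (hN : 1 ≤ P.N) {v : ℕ → H} {n : ℕ} {X : ℝ} (hn : 1 ≤ n)
    (h1 : ‖v n‖ ≤ X) (h2 : ‖v (n - 1)‖ ≤ X) : ‖P.wavg v n‖ ≤ X := by
  have hθ := P.half_le_σStar (P.τ_pos hN hn)
  have hθ1 := P.σStar_le_one (P.τ_pos hN hn)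
  have e : P.wavg v n = P.σStar n • v n + (1 - P.σStar n) • v (n - 1) := by simp [wavg, σ]
  calc ‖P.wavg v n‖ ≤ P.σStar n * ‖v n‖ + (1 - P.σStar n) * ‖v (n - 1)‖ := by
        rw [e]
        refine (norm_add_le _ _).trans (le_of_eq ?_)
        rw [norm_smul, norm_smul, Real.norm_of_nonneg (by linarith),
          Real.norm_of_nonneg (by linarith)]
    _ ≤ P.σStar n * X + (1 - P.σStar n) * X := by gcongr
    _ = X := by ring

section Prod

variable {V W : Type*} [AddCommGroup V] [Module ℝ V] [AddCommGroup W] [Module ℝ W]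

lemma fst_DN (U : ℕ → V × W) (n : ℕ) : (P.DN U n).1 = P.DN (fun k => (U k).1) n := by
  simp [DN, Prod.fst_sum]

lemma snd_DN (U : ℕ → V × W) (n : ℕ) : (P.DN U n).2 = P.DN (fun k => (U k).2) n := by
  simp [DN, Prod.snd_sum]

end Prod

/-- The constant of the theorem dominates the barrier function at the final time. -/
lemma barrier_le [NeZero m] :
    11 / 4 * P.barrier P.T ≤ 11 * P.T ^ P.α 0 / (4 * ⨅ s, P.μ s * Real.Gamma (1 + P.α s)) := by
  have hpos : ∀ s, 0 < P.μ s * Real.Gamma (1 + P.α s) := fun s =>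
    mul_pos (P.μ_pos s) (Real.Gamma_pos_of_pos (by linarith [P.α_pos s]))
  have hle : ⨅ s, P.μ s * Real.Gamma (1 + P.α s) ≤ P.μ 0 * Real.Gamma (1 + P.α 0) :=
    ciInf_le (Set.finite_range _).bddBelow 0
  obtain ⟨s, hs⟩ := exists_eq_ciInf_of_finite (f := fun s => P.μ s * Real.Gamma (1 + P.α s))
  have hinf : 0 < ⨅ s, P.μ s * Real.Gamma (1 + P.α s) := hs ▸ hpos s
  have hT : 0 ≤ P.T ^ P.α 0 := Real.rpow_nonneg P.T_pos.le _
  calc 11 / 4 * P.barrier P.T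
      = 11 * P.T ^ P.α 0 / (4 * (P.μ 0 * Real.Gamma (1 + P.α 0))) := by
        rw [barrier]; field_simp
    _ ≤ _ := by gcongr

end TimeParams

lemma norm_le_maxSource {m d : ℕ} (P : TimeParams m) {Ω : Set (EuclideanSpace ℝ (Fin d))}
    (f : ℝ → L2 Ω) {n j : ℕ} (hj : 1 ≤ j) (hjn : j ≤ n) :
    ‖f (P.tσ j)‖ ≤ maxSource P f n :=
  le_ciSup (f := fun j : Set.Icc 1 n => ‖f (P.tσ (j : ℕ))‖) (Set.finite_range _).bddAbove
    ⟨j, hj, hjn⟩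

/-! ### A priori bounds for the fully discrete scheme -/

section Scheme

variable {m d : ℕ} {P : TimeParams m} {Ω : Set (EuclideanSpace ℝ (Fin d))}
  {Vh : Submodule ℝ (L2 Ω × L2Vec Ω)} {a : ℝ → ℝ} {m₁ : ℝ} {f : ℝ → L2 Ω}
  {U : ℕ → L2 Ω × L2Vec Ω}

/-- The first step and the later ones differ only in the argument of `a`, which is irrelevant to
stability. -/
lemma IsFullyDiscreteSolution.exists_diffusion (hU : IsFullyDiscreteSolution P Vh a f U)
    (ha : ∀ x, m₁ ≤ a x) {n : ℕ} (hn : 1 ≤ n) (hnN : n ≤ P.N) :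
    ∃ A, m₁ ≤ A ∧ ∀ v ∈ Vh, inner ℝ (P.DN (fun k => (U k).1) n) v.1
      + A * inner ℝ (P.wavg (fun k => (U k).2) n) v.2 = inner ℝ (f (P.tσ n)) v.1 := by
  rcases hn.lt_or_eq with hn | rfl
  · exact ⟨_, ha _, fun v hv => by rw [← P.fst_DN]; exact hU.step n hn hnN v hv⟩
  · exact ⟨_, ha _, fun v hv => by rw [← P.fst_DN]; exact hU.first_step hnN v hv⟩

lemma IsFullyDiscreteSolution.wavg_mem (hU : IsFullyDiscreteSolution P Vh a f U) {n : ℕ}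
    (hnN : n ≤ P.N) : P.wavg U n ∈ Vh :=
  Vh.add_mem (Vh.smul_mem _ (hU.mem n hnN)) (Vh.smul_mem _ (hU.mem _ (by omega)))

lemma IsFullyDiscreteSolution.DN_mem (hU : IsFullyDiscreteSolution P Vh a f U) {n : ℕ}
    (hnN : n ≤ P.N) : P.DN U n ∈ Vh :=
  Vh.sum_mem fun j hj => Vh.smul_mem _ (Vh.sub_mem
    (hU.mem j ((Finset.mem_Icc.1 hj).2.trans hnN))
    (hU.mem _ ((Nat.sub_le _ _).trans ((Finset.mem_Icc.1 hj).2.trans hnN))))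

/-- Stability in `L²(Ω)`. -/
lemma IsFullyDiscreteSolution.norm_fst_le [NeZero m]
    (hU : IsFullyDiscreteSolution P Vh a f U)
    (hm₁ : 0 < m₁) (ha : ∀ x, m₁ ≤ a x) {n : ℕ} (hn : 1 ≤ n) (hnN : n ≤ P.N) :
    ‖(U n).1‖ ≤ ‖(U 0).1‖ + 4 * maxSource P f n * P.barrier P.T := by
  have hN : 1 ≤ P.N := hn.trans hnN
  set F := maxSource P f n
  have hF : 0 ≤ F := (norm_nonneg _).trans (norm_le_maxSource P f hn le_rfl)
  -- Evaluating at the index of largest norm `X` makes the source contribution linear in `X`, so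
  -- that one factor `X` can be cancelled from `X² ≤ ‖U⁰‖² + 4FXW`, where `W` is `P.barrier P.T`.
  obtain ⟨k, hk, hmax⟩ := Finset.exists_max_image (Finset.range (n + 1)) (fun k => ‖(U k).1‖)
    ⟨0, by simp⟩
  have hkn : k ≤ n := Nat.lt_succ_iff.1 (Finset.mem_range.1 hk)
  have hmax' : ∀ j ≤ n, ‖(U j).1‖ ≤ ‖(U k).1‖ := fun j hj =>
    hmax j (Finset.mem_range.2 (Nat.lt_succ_of_le hj))
  set X := ‖(U k).1‖
  have hX : 0 ≤ X := norm_nonneg _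
  have hW := P.barrier_nonneg P.T_pos.le
  have hstep : ∀ i, 1 ≤ i → i ≤ n → ∑ j ∈ Finset.Icc 1 i,
      P.g i j * (‖(U j).1‖ ^ 2 - ‖(U (j - 1)).1‖ ^ 2) ≤ 2 * F * X := fun i hi hin => by
    obtain ⟨A, hA, h⟩ := hU.exists_diffusion ha hi (hin.trans hnN)
    have h1 := h _ (hU.wavg_mem (hin.trans hnN))
    have h2 := P.half_sum_norm_sq_le_inner_wavg hN (fun k => (U k).1) hi
    have h3 : 0 ≤ A * inner ℝ (P.wavg (fun k => (U k).2) i) (P.wavg U i).2 :=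
      mul_nonneg (hm₁.le.trans hA) real_inner_self_nonneg
    have h4 : inner ℝ (f (P.tσ i)) (P.wavg U i).1 ≤ F * X :=
      (real_inner_le_norm _ _).trans (mul_le_mul (norm_le_maxSource P f hi hin)
        (P.norm_wavg_le hN (v := fun k => (U k).1) hi (hmax' i hin) (hmax' _ (by omega)))
        (norm_nonneg _) hF)
    rw [real_inner_comm] at h2
    have h5 : inner ℝ (P.DN (fun k => (U k).1) i) (P.wavg (fun k => (U k).1) i)
        = inner ℝ (P.DN (fun k => (U k).1) i) (P.wavg U i).1 := rfl
    rw [h5] at h2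
    linarith
  have hbound := P.le_add_barrier_of_sum_le hN (z := fun j => ‖(U j).1‖ ^ 2) hnN
    (mul_nonneg (mul_nonneg zero_le_two hF) hX) hstep k hkn
  have h0 := hmax' 0 (Nat.zero_le _)
  refine (hmax' n le_rfl).trans ?_
  rcases hX.eq_or_lt with hX0 | hX0
  · rw [← hX0]
    positivity
  · refine le_of_mul_le_mul_right ?_ hX0
    change X ^ 2 ≤ _ at hbound
    have := mul_le_mul_of_nonneg_left h0 (norm_nonneg (U 0).1)
    linarith

/-- Stability of the gradient in `L²(Ω; ℝ^d)`. -/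
lemma IsFullyDiscreteSolution.norm_snd_sq_le [NeZero m]
    (hU : IsFullyDiscreteSolution P Vh a f U)
    (hm₁ : 0 < m₁) (ha : ∀ x, m₁ ≤ a x) {n : ℕ} (hn : 1 ≤ n) (hnN : n ≤ P.N) :
    ‖(U n).2‖ ^ 2 ≤ ‖(U 0).2‖ ^ 2 + maxSource P f n ^ 2 / m₁ * P.barrier P.T := by
  have hN : 1 ≤ P.N := hn.trans hnN
  set F := maxSource P f n
  have hstep : ∀ i, 1 ≤ i → i ≤ n → ∑ j ∈ Finset.Icc 1 i,
      P.g i j * (‖(U j).2‖ ^ 2 - ‖(U (j - 1)).2‖ ^ 2) ≤ F ^ 2 / (2 * m₁) := fun i hi hin => by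
    obtain ⟨A, hA, h⟩ := hU.exists_diffusion ha hi (hin.trans hnN)
    have h1 := h _ (hU.DN_mem (hin.trans hnN))
    rw [P.fst_DN, P.snd_DN, real_inner_self_eq_norm_sq] at h1
    have h2 := P.half_sum_norm_sq_le_inner_wavg hN (fun k => (U k).2) hi
    have h3 := real_inner_le_norm (f (P.tσ i)) (P.DN (fun k => (U k).1) i)
    have h4 : ‖f (P.tσ i)‖ ^ 2 ≤ F ^ 2 := by
      gcongr
      exact norm_le_maxSource P f hi hin
    have hA0 := hm₁.trans_le hA
    -- Testing with `DN U` leaves `(f, D) - ‖D‖² ≤ ‖f‖²/4` on the right, where `D` is the `L²`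
    -- component of `DN U`.
    have h5 : inner ℝ (P.wavg (fun k => (U k).2) i) (P.DN (fun k => (U k).2) i)
        ≤ F ^ 2 / (4 * A) := by
      rw [le_div_iff₀ (by positivity)]
      nlinarith [sq_nonneg (2 * ‖P.DN (fun k => (U k).1) i‖ - ‖f (P.tσ i)‖)]
    have h6 : F ^ 2 / (4 * A) ≤ F ^ 2 / (4 * m₁) := by gcongr
    have h7 : F ^ 2 / (2 * m₁) = 2 * (F ^ 2 / (4 * m₁)) := by field_simp; norm_num
    linarith
  have hbound := P.le_add_barrier_of_sum_le hN (z := fun j => ‖(U j).2‖ ^ 2) hnN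
    (by positivity) hstep n le_rfl
  refine hbound.trans (le_of_eq ?_)
  field_simp

end Scheme

lemma le_two_mul_mul_max_mul {E B u x : ℝ} (hE : 1 ≤ E) (hu : 0 ≤ u) (hx : x ≤ u + 2 * B) :
    x ≤ 2 * E * max 1 B * (1 + u) := by
  have h1 : 1 ≤ max 1 B := le_max_left _ _
  have h2 : B ≤ max 1 B := le_max_right _ _
  have h3 : max 1 B ≤ E * max 1 B := le_mul_of_one_le_left (by linarith) hE
  have h4 : u ≤ E * max 1 B * u := le_mul_of_one_le_left hu (h1.trans h3)
  linarith

end FracNonlocal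

theorem mainTheorem4 {m d : ℕ} [NeZero m] (P : FracNonlocal.TimeParams m)
    (Ω : Set (EuclideanSpace ℝ (Fin d))) (hΩ : IsOpen Ω) (hΩb : Bornology.IsBounded Ω)
    (Vh : Submodule ℝ (FracNonlocal.L2 Ω × FracNonlocal.L2Vec Ω))
    (hVh : Vh ≤ FracNonlocal.H10 Ω) (hfin : FiniteDimensional ℝ Vh)
    (a : ℝ → ℝ) (m₁ : ℝ) (hm₁ : 0 < m₁) (ha : ∀ x, m₁ ≤ a x)
    (f : ℝ → FracNonlocal.L2 Ω)
    (U : ℕ → FracNonlocal.L2 Ω × FracNonlocal.L2Vec Ω)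
    (hU : FracNonlocal.IsFullyDiscreteSolution P Vh a f U)
    (n : ℕ) (hn : 1 ≤ n) (hnN : n ≤ P.N) :
    ‖(U n).1‖ ≤
      (2 * FracNonlocal.mittagLeffler (P.α 0) (11 / (2 * P.μ 0) * P.t n ^ P.α 0)
        * max 1
          ((11 * P.T ^ P.α 0 / (4 * ⨅ s, P.μ s * Real.Gamma (1 + P.α s)) + 1)
            * FracNonlocal.maxSource P f n))
        * (1 + ‖(U 0).1‖) ∧
    ‖(U n).2‖ ≤
      (2 * FracNonlocal.mittagLeffler (P.α 0) (11 / (2 * P.μ 0) * P.t n ^ P.α 0)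
        * max 1
          (1 / √m₁ * (11 * P.T ^ P.α 0 / (4 * ⨅ s, P.μ s * Real.Gamma (1 + P.α s)) + 1)
            * FracNonlocal.maxSource P f n))
        * (1 + ‖(U 0).2‖) := by
  have hN : 1 ≤ P.N := hn.trans hnN
  have hE : 1 ≤ FracNonlocal.mittagLeffler (P.α 0) (11 / (2 * P.μ 0) * P.t n ^ P.α 0) :=
    FracNonlocal.one_le_mittagLeffler (P.α_pos 0) (mul_nonneg
      (div_nonneg (by norm_num) (mul_nonneg zero_le_two (P.μ_pos 0).le))
      (Real.rpow_nonneg (P.t_nonneg hN n) _))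
  have hK := P.barrier_le
  have hW := P.barrier_nonneg P.T_pos.le
  have h1 := hU.norm_fst_le hm₁ ha hn hnN
  have h2 := hU.norm_snd_sq_le hm₁ ha hn hnN
  have hF : 0 ≤ FracNonlocal.maxSource P f n :=
    (norm_nonneg _).trans (FracNonlocal.norm_le_maxSource P f hn le_rfl)
  set K := 11 * P.T ^ P.α 0 / (4 * ⨅ s, P.μ s * Real.Gamma (1 + P.α s))
  set F := FracNonlocal.maxSource P f n
  set W := P.barrier P.T
  have hKW : 2 * W ≤ K := by linarith
  constructor
  · refine FracNonlocal.le_two_mul_mul_max_mul hE (norm_nonneg _) ?_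
    have := mul_le_mul_of_nonneg_right hKW hF
    linarith
  · have hs : 0 < √m₁ := Real.sqrt_pos.2 hm₁
    rw [mul_right_comm (1 / √m₁)]
    set F' := 1 / √m₁ * F
    have hF' : 0 ≤ F' := by positivity
    have hsq : F ^ 2 / m₁ = F' ^ 2 := by
      rw [mul_pow, div_pow, one_pow, Real.sq_sqrt hm₁.le]; ring
    have hKF : 0 ≤ (K + 1) * F' := mul_nonneg (by linarith) hF'
    have h3 : ‖(U n).2‖ ≤ ‖(U 0).2‖ + (K + 1) * F' := by
      refine (abs_le_of_sq_le_sq' ?_ (add_nonneg (norm_nonneg _) hKF)).2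
      rw [hsq] at h2
      -- With this, `‖∇U⁰‖² + F'² W` is at most the square of `‖∇U⁰‖ + (K+1) F'`.
      have hWK : W ≤ (K + 1) ^ 2 := by nlinarith
      have h4 := mul_le_mul_of_nonneg_left hWK (sq_nonneg F')
      have h5 : 0 ≤ ‖(U 0).2‖ * ((K + 1) * F') := mul_nonneg (norm_nonneg _) hKF
      linarith
    rw [mul_comm F' (K + 1)]
    exact FracNonlocal.le_two_mul_mul_max_mul hE (norm_nonneg _) (by linarith)
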